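/- All graphs are finite and simple. A \emph{tree decomposition} of a graph $G$ is a tree $T$ together with bags $V_t \subseteq V(G)$, $t \in V(T)$, such that $V(G) = \bigcup_{t} V_t$, every edge of $G$ has both ends in some bag, and, whenever $v \in V_{t_1} \cap V_{t_2}$, the vertex $v$ lies in $V_t$ for each $t$ on the path connecting $t_1$ and $t_2$ in $T$. It has width $k$ if each bag has at most $k+1$ elements. The \emph{tree-width} of $G$ is the smallest integer $k \ge 0$ for which $G$ has a tree decomposition of width $k$, and the \emph{path-width} of $G$ is the smallest integer $k \ge 0$ for which $G$ has a tree decomposition of width $k$ whose tree is a path. The \emph{list chromatic index} $\mathrm{ch}'(G)$ is the smallest integer $k \ge 0$ such that for every assignment of lists $L : E(G) \to \mathcal{P}(\mathbb{N})$ with $|L(e)| \ge k$ for each edge $e$ there is a map $C : E(G) \to \mathbb{N}$ with $C(e) \in L(e)$ for each edge $e$ and $C(e) \ne C(f)$ for any two distinct edges $e, f$ with a common end. Theorem. Let $G$ be a graph with maximum degree $\Delta$. Then $\mathrm{ch}'(G) = \Delta$ if $G$ has (1) tree-width at most $3$ and $\Delta \ge 7$, (2) path-width at most $3$ and $\Delta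 \ge 6$, or (3) path-width at most $4$ and $\Delta \ge 10$. -/

import Mathlib

namespace SimpleGraph

universe u

variable {V : Type u}

/-- A tree decomposition of `G`: a finite tree together with a bag of vertices of `G` at each node.
For universe reasons the nodes of the tree live in `Type`, which is no restriction as the tree is
finite. -/
structure TreeDecomposition (G : SimpleGraph V) where
  /-- the nodes of the tree -/
  node : Type
  finite_node : Finite node
  /-- the tree -/
  tree : SimpleGraph node
  isTree : tree.IsTree
  /-- the bags -/
  bag : node → Finset V
  exists_mem_bag : ∀ v : V, ∃ t, v ∈ bag t
  exists_adj_mem_bag : ∀ v w : V, G.Adj v w → ∃ t, v ∈ bag t ∧ w ∈ bag t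
  mem_bag_of_mem_path : ∀ (v : V) (t₁ t₂ : node), v ∈ bag t₁ → v ∈ bag t₂ →
    ∀ p : tree.Walk t₁ t₂, p.IsPath → ∀ t ∈ p.support, v ∈ bag t

/-- A tree decomposition has width `k` if each bag has at most `k + 1` elements. -/
def TreeDecomposition.HasWidth {G : SimpleGraph V} (D : G.TreeDecomposition) (k : ℕ) : Prop :=
  ∀ t, (D.bag t).card ≤ k + 1

/-- A path decomposition is a tree decomposition whose tree is a path. -/
def TreeDecomposition.IsPathDecomposition {G : SimpleGraph V} (D : G.TreeDecomposition) : Prop :=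
  ∃ n : ℕ, Nonempty (D.tree ≃g pathGraph n)

/-- The tree-width of a (finite) graph: the least `k` for which there is a tree decomposition of
width `k`. -/
noncomputable def treeWidth (G : SimpleGraph V) : ℕ :=
  sInf {k : ℕ | ∃ D : G.TreeDecomposition, D.HasWidth k}

/-- The path-width of a (finite) graph: the least `k` for which there is a path decomposition of
width `k`. -/
noncomputable def pathWidth (G : SimpleGraph V) : ℕ :=
  sInf {k : ℕ | ∃ D : G.TreeDecomposition, D.IsPathDecomposition ∧ D.HasWidth k}

/-- `C` is an `L`-edge-colouring of `G`: each edge gets a colour from its list, and distinct edges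
with a common end vertex get distinct colours. -/
def IsListEdgeColouring (G : SimpleGraph V) (L : G.edgeSet → Set ℕ) (C : G.edgeSet → ℕ) : Prop :=
  (∀ e, C e ∈ L e) ∧ ∀ e f, G.lineGraph.Adj e f → C e ≠ C f

/-- `G` is `k`-edge-choosable: whenever all lists have size at least `k`, there is an edge-colouring
from the lists. -/
def EdgeChoosable (G : SimpleGraph V) (k : ℕ) : Prop :=
  ∀ L : G.edgeSet → Set ℕ, (∀ e, (k : ℕ∞) ≤ (L e).encard) →
    ∃ C : G.edgeSet → ℕ, G.IsListEdgeColouring L C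

/-- The list chromatic index of a (finite) graph: the least `k` for which it is
`k`-edge-choosable. -/
noncomputable def listChromaticIndex (G : SimpleGraph V) : ℕ :=
  sInf {k : ℕ | G.EdgeChoosable k}

end SimpleGraph

namespace SimpleGraph

/-! ### Stable matchings and Galvin's theorem -/

/-- Every finite set of cells of a table, with each row linearly ordered by `r` and each column
linearly ordered by `q`, contains a stable matching. -/
theorem exists_stable_matching {α β : Type*} (r q : α → β → ℕ) (F : Finset (α × β))
    (hr : ∀ x w w', (x, w) ∈ F → (x, w') ∈ F → r x w = r x w' → w = w')
    (hq : ∀ x x' w, (x, w) ∈ F → (x', w) ∈ F → q x w = q x' w → x = x') :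
    ∃ M ⊆ F, (∀ x w w', (x, w) ∈ M → (x, w') ∈ M → w = w') ∧
      (∀ x x' w, (x, w) ∈ M → (x', w) ∈ M → x = x') ∧
      ∀ x w, (x, w) ∈ F → (x, w) ∉ M →
        (∃ w', (x, w') ∈ M ∧ r x w' < r x w) ∨ (∃ x', (x', w) ∈ M ∧ q x' w < q x w) := by
  classical
  induction hn : F.card using Nat.strong_induction_on generalizing F with
  | _ n ih =>
  -- Gale–Shapley by deletion, smaller rank being preferred. If `w` is the first choice of both `x`
  -- and `x'` and prefers `x`, delete `(x', w)`. A stable matching of the rest still dominates that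
  -- cell: either `(x, w)` is chosen, or `w` gets something better, since `w` is the best option of
  -- `x`. Without such a conflict, all first choices form a matching.
  by_cases hconf : ∃ x x' w, (x, w) ∈ F ∧ (x', w) ∈ F ∧ q x w < q x' w ∧
      (∀ w', (x, w') ∈ F → r x w ≤ r x w') ∧ (∀ w', (x', w') ∈ F → r x' w ≤ r x' w')
  · obtain ⟨x, x', w, hx, hx', hlt, hmin, -⟩ := hconf
    obtain ⟨M, hMF, h1, h2, h3⟩ := ih (F.erase (x', w)).card
      (hn ▸ Finset.card_erase_lt_of_mem hx') (F.erase (x', w))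
      (fun y w w' h h' => hr y w w' (Finset.mem_of_mem_erase h) (Finset.mem_of_mem_erase h'))
      (fun y y' w h h' => hq y y' w (Finset.mem_of_mem_erase h) (Finset.mem_of_mem_erase h')) rfl
    refine ⟨M, hMF.trans (Finset.erase_subset _ _), h1, h2, fun y u hy hyM => ?_⟩
    by_cases he : (y, u) = (x', w)
    · obtain ⟨rfl, rfl⟩ := Prod.mk.inj he
      right
      by_cases hxM : (x, u) ∈ M
      · exact ⟨x, hxM, hlt⟩
      · have hxe : (x, u) ∈ F.erase (y, u) := by
          refine Finset.mem_erase.2 ⟨fun h => ?_, hx⟩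
          rw [(Prod.mk.inj h).1] at hlt
          exact lt_irrefl _ hlt
        rcases h3 x u hxe hxM with ⟨w', hw', h⟩ | ⟨z, hz, h⟩
        · exact absurd h (not_lt.2 (hmin w' (Finset.mem_of_mem_erase (hMF hw'))))
        · exact ⟨z, hz, h.trans hlt⟩
    · exact h3 y u (Finset.mem_erase.2 ⟨he, hy⟩) hyM
  · push Not at hconf
    refine ⟨F.filter fun e => ∀ w', (e.1, w') ∈ F → r e.1 e.2 ≤ r e.1 w', Finset.filter_subset _ _,
      ?_, ?_, ?_⟩
    · intro x w w' h h'
      simp only [Finset.mem_filter] at h h'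
      exact hr x w w' h.1 h'.1 (le_antisymm (h.2 _ h'.1) (h'.2 _ h.1))
    · intro x x' w h h'
      simp only [Finset.mem_filter] at h h'
      by_contra hne
      rcases lt_trichotomy (q x w) (q x' w) with hlt | heq | hlt
      · obtain ⟨w', hw', hl⟩ := hconf x x' w h.1 h'.1 hlt h.2
        exact absurd (h'.2 w' hw') (not_le.2 hl)
      · exact hne (hq x x' w h.1 h'.1 heq)
      · obtain ⟨w', hw', hl⟩ := hconf x' x w h'.1 h.1 hlt h'.2
        exact absurd (h.2 w' hw') (not_le.2 hl)
    · intro x w h hM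
      left
      obtain ⟨e, he, hemin⟩ := Finset.exists_min_image (F.filter fun e => e.1 = x)
        (fun e => r x e.2) ⟨(x, w), by simp [h]⟩
      obtain ⟨y, w'⟩ := e
      simp only [Finset.mem_filter] at he
      obtain ⟨he, rfl⟩ := he
      have hmin : ∀ u, (y, u) ∈ F → r y w' ≤ r y u := fun u hu => hemin (y, u) (by simp [hu])
      refine ⟨w', by simpa [he] using hmin, lt_of_le_of_ne (hmin w h) fun heq => hM ?_⟩
      rw [← hr y w' w he h heq]
      simpa [he] using hmin

/-- Galvin's theorem in the form of Borodin, Kostochka and Woodall: a bipartite graph, given as a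
set of cells of a table, can be coloured from lists if each list is longer than the number of
preferred cells. -/
theorem exists_colouring_of_card_lt {α β : Type*} [DecidableEq α] [DecidableEq β]
    (r q : α → β → ℕ) (F : Finset (α × β))
    (L : α → β → Finset ℕ)
    (hr : ∀ x w w', (x, w) ∈ F → (x, w') ∈ F → r x w = r x w' → w = w')
    (hq : ∀ x x' w, (x, w) ∈ F → (x', w) ∈ F → q x w = q x' w → x = x')
    (hL : ∀ x w, (x, w) ∈ F → (F.filter fun e => e.1 = x ∧ r x e.2 < r x w).card +
      (F.filter fun e => e.2 = w ∧ q e.1 w < q x w).card < (L x w).card) :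
    ∃ c : α → β → ℕ, (∀ x w, (x, w) ∈ F → c x w ∈ L x w) ∧
      (∀ x w w', (x, w) ∈ F → (x, w') ∈ F → c x w = c x w' → w = w') ∧
      (∀ x x' w, (x, w) ∈ F → (x', w) ∈ F → c x w = c x' w → x = x') := by
  induction hn : F.card using Nat.strong_induction_on generalizing F L with
  | _ n ih =>
  rcases F.eq_empty_or_nonempty with rfl | ⟨⟨x₀, w₀⟩, h₀⟩
  · exact ⟨fun _ _ => 0, by simp⟩
  obtain ⟨a, ha⟩ : (L x₀ w₀).Nonempty :=
    Finset.card_pos.1 ((Nat.zero_le _).trans_lt (hL x₀ w₀ h₀))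
  -- Colour a stable matching among the cells that allow `a` with `a`. Every other such cell loses
  -- one colour but also at least one preferred cell, so the strict inequality survives.
  set A := F.filter fun e => a ∈ L e.1 e.2 with hA
  have hAF : A ⊆ F := Finset.filter_subset _ _
  obtain ⟨M, hMA, h1, h2, h3⟩ := exists_stable_matching r q A
    (fun x w w' h h' => hr x w w' (hAF h) (hAF h')) (fun x x' w h h' => hq x x' w (hAF h) (hAF h'))
  have hMF := hMA.trans hAF
  have hMne : M.Nonempty := by
    have h₀A : (x₀, w₀) ∈ A := by simp [hA, h₀, ha]
    by_contra hne
    rw [Finset.not_nonempty_iff_eq_empty] at hne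
    subst hne
    simpa using h3 x₀ w₀ h₀A
  obtain ⟨c, hc1, hc2, hc3⟩ := ih (F \ M).card
    (hn ▸ Finset.card_lt_card (Finset.sdiff_ssubset hMF hMne)) (F \ M)
    (fun x w => (L x w).erase a)
    (fun x w w' h h' => hr x w w' (Finset.sdiff_subset h) (Finset.sdiff_subset h'))
    (fun x x' w h h' => hq x x' w (Finset.sdiff_subset h) (Finset.sdiff_subset h')) (by
      intro x w h
      obtain ⟨hF, hM⟩ := Finset.mem_sdiff.1 h
      have hb := hL x w hF
      have s1 : ((F \ M).filter fun e => e.1 = x ∧ r x e.2 < r x w) ⊆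
          F.filter fun e => e.1 = x ∧ r x e.2 < r x w :=
        Finset.filter_subset_filter _ Finset.sdiff_subset
      have s2 : ((F \ M).filter fun e => e.2 = w ∧ q e.1 w < q x w) ⊆
          F.filter fun e => e.2 = w ∧ q e.1 w < q x w :=
        Finset.filter_subset_filter _ Finset.sdiff_subset
      have l1 := Finset.card_le_card s1
      have l2 := Finset.card_le_card s2
      by_cases haL : a ∈ L x w
      · have he := Finset.card_erase_add_one haL
        rcases h3 x w (by simp [hA, hF, haL]) hM with ⟨w', hw', hlt⟩ | ⟨x', hx', hlt⟩
        · have := Finset.card_lt_card (Finset.ssubset_iff_subset_ne.2 ⟨s1, fun h => by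
            have : (x, w') ∈ F.filter fun e => e.1 = x ∧ r x e.2 < r x w := by
              simp [hMF hw', hlt]
            rw [← h] at this
            simp [hw'] at this⟩)
          omega
        · have := Finset.card_lt_card (Finset.ssubset_iff_subset_ne.2 ⟨s2, fun h => by
            have : (x', w) ∈ F.filter fun e => e.2 = w ∧ q e.1 w < q x w := by
              simp [hMF hx', hlt]
            rw [← h] at this
            simp [hx'] at this⟩)
          omega
      · rw [Finset.erase_eq_of_notMem haL]
        omega) rfl
  have hca : ∀ x w, (x, w) ∈ F → (x, w) ∉ M → c x w ≠ a := fun x w h h' =>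
    Finset.ne_of_mem_erase (hc1 x w (Finset.mem_sdiff.2 ⟨h, h'⟩))
  refine ⟨fun x w => if (x, w) ∈ M then a else c x w, ?_, ?_, ?_⟩
  · intro x w h
    by_cases hM : (x, w) ∈ M
    · simpa [hM] using (Finset.mem_filter.1 (hMA hM)).2
    · simpa [hM] using Finset.mem_of_mem_erase (hc1 x w (Finset.mem_sdiff.2 ⟨h, hM⟩))
  · intro x w w' h h' heq
    by_cases hM : (x, w) ∈ M <;> by_cases hM' : (x, w') ∈ M <;>
      simp only [hM, hM', if_true, if_false] at heq
    · exact h1 x w w' hM hM'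
    · exact absurd heq.symm (hca x w' h' hM')
    · exact absurd heq (hca x w h hM)
    · exact hc2 x w w' (Finset.mem_sdiff.2 ⟨h, hM⟩) (Finset.mem_sdiff.2 ⟨h', hM'⟩) heq
  · intro x x' w h h' heq
    by_cases hM : (x, w) ∈ M <;> by_cases hM' : (x', w) ∈ M <;>
      simp only [hM, hM', if_true, if_false] at heq
    · exact h2 x x' w hM hM'
    · exact absurd heq.symm (hca x' w h' hM')
    · exact absurd heq (hca x w h hM)
    · exact hc3 x x' w (Finset.mem_sdiff.2 ⟨h, hM⟩) (Finset.mem_sdiff.2 ⟨h', hM'⟩) heq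

/-! ### List colourings and reducible subgraphs -/

/-- `H` has a proper edge-colouring from the lists `R`. -/
def ListColourable {V : Type*} (H : SimpleGraph V) (R : Sym2 V → Finset ℕ) : Prop :=
  ∃ C : Sym2 V → ℕ, (∀ u w, H.Adj u w → C s(u, w) ∈ R s(u, w)) ∧
    ∀ u v w, H.Adj u v → H.Adj u w → C s(u, v) = C s(u, w) → v = w

/-- `G` is edge-colourable from all finite lists of size at least `k`. -/
def FinChoosable {V : Type*} (G : SimpleGraph V) (k : ℕ) : Prop :=
  ∀ L : Sym2 V → Finset ℕ, (∀ u w, G.Adj u w → k ≤ (L s(u, w)).card) → G.ListColourable L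

section

variable {V : Type*} [Fintype V]

open scoped Classical in
/-- Extending a colouring of a subgraph: each vertex `u` of the subgraph forbids at most `degree u`
colours at the remaining edges at `u`. -/
theorem FinChoosable.extend {G G' : SimpleGraph V} {k : ℕ} (hle : G' ≤ G) (hG' : G'.FinChoosable k)
    (hext : ∀ R : Sym2 V → Finset ℕ,
      (∀ u w, (G \ G').Adj u w → k ≤ (R s(u, w)).card + G'.degree u + G'.degree w) →
      (G \ G').ListColourable R) : G.FinChoosable k := by
  intro L hL
  obtain ⟨C₀, hC₀, hp₀⟩ := hG' L fun u w h => hL u w (hle h)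
  -- The remaining edges keep the colours not used on edges of `G'` that meet them.
  obtain ⟨C₁, hC₁, hp₁⟩ := hext
    (fun e => L e \ (G'.edgeFinset.filter fun f => ∃ z ∈ e, z ∈ f).image C₀) (by
      intro u w h
      have hsub : (G'.edgeFinset.filter fun f => ∃ z ∈ s(u, w), z ∈ f) ⊆
          G'.incidenceFinset u ∪ G'.incidenceFinset w := by
        intro f hf
        simp only [Finset.mem_filter, mem_edgeFinset, Sym2.mem_iff, exists_eq_or_imp,
          exists_eq_left] at hf
        simp only [Finset.mem_union, mem_incidenceFinset, incidenceSet, Set.mem_sep_iff]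
        tauto
      have h1 := Finset.card_le_card hsub
      have h2 := Finset.card_union_le (G'.incidenceFinset u) (G'.incidenceFinset w)
      rw [card_incidenceFinset_eq_degree, card_incidenceFinset_eq_degree] at h2
      have h3 := Finset.card_image_le (s := G'.edgeFinset.filter fun f => ∃ z ∈ s(u, w), z ∈ f)
        (f := C₀)
      have h4 := Finset.le_card_sdiff
        ((G'.edgeFinset.filter fun f => ∃ z ∈ s(u, w), z ∈ f).image C₀) (L s(u, w))
      have h5 := hL u w ((sdiff_le : G \ G' ≤ G) h)
      omega)
  have hmix : ∀ u v w, G'.Adj u v → (G \ G').Adj u w → C₀ s(u, v) ≠ C₁ s(u, w) := by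
    intro u v w h h' heq
    have := hC₁ u w h'
    simp only [Finset.mem_sdiff, Finset.mem_image, Finset.mem_filter, mem_edgeFinset] at this
    exact this.2 ⟨s(u, v), ⟨h, u, by simp, by simp⟩, heq⟩
  have hsd : ∀ u w, G.Adj u w → ¬ G'.Adj u w → (G \ G').Adj u w := fun u w h h' => by
    rw [sdiff_adj]; exact ⟨h, h'⟩
  refine ⟨fun e => if e ∈ G'.edgeSet then C₀ e else C₁ e, ?_, ?_⟩
  · intro u w h
    by_cases h' : G'.Adj u w
    · simpa [h'] using hC₀ u w h'
    · have := hC₁ u w (hsd u w h h')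
      simp only [Finset.mem_sdiff] at this
      simpa [h'] using this.1
  · intro u v w hv hw heq
    by_cases hv' : G'.Adj u v <;> by_cases hw' : G'.Adj u w <;>
      simp only [mem_edgeSet, hv', hw', if_true, if_false] at heq
    · exact hp₀ u v w hv' hw' heq
    · exact absurd heq (hmix u v w hv' (hsd u w hw hw'))
    · exact absurd heq.symm (hmix u w v hw' (hsd u v hv hv'))
    · exact hp₁ u v w (hsd u v hv hv') (hsd u w hw hw') heq

theorem card_filter_lt_le {ι : Type*} (s : Finset ι) (f : ι → ℕ) (hf : Set.InjOn f s) (n : ℕ) :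
    (s.filter fun i => f i < n).card ≤ n := by
  simpa using Finset.card_le_card_of_injOn (t := Finset.range n) f
    (fun i hi => by simpa using (Finset.mem_filter.1 hi).2)
    (hf.mono fun i hi => (Finset.mem_filter.1 hi).1)

open scoped Classical in
/-- A stable set of vertices `x i` is reducible if its neighbourhoods can be ranked suitably. -/
theorem FinChoosable.of_stable {G : SimpleGraph V} {k : ℕ} {ι : Type*} [Fintype ι] (x : ι → V)
    (hinj : Function.Injective x) (hst : ∀ i j, ¬ G.Adj (x i) (x j))
    (hG : (G.deleteEdges {e | ∃ i, x i ∈ e}).FinChoosable k) (r q : ι → V → ℕ)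
    (hr : ∀ i w w', G.Adj (x i) w → G.Adj (x i) w' → r i w = r i w' → w = w')
    (hq : ∀ i j w, G.Adj (x i) w → G.Adj (x j) w → q i w = q j w → i = j)
    (hb : ∀ i w, G.Adj (x i) w →
      r i w + q i w + G.degree w < k + (Finset.univ.filter fun j => G.Adj (x j) w).card) :
    G.FinChoosable k := by
  obtain ⟨G', hG'⟩ : ∃ G', G' = G.deleteEdges {e | ∃ i, x i ∈ e} := ⟨_, rfl⟩
  rw [← hG'] at hG
  refine FinChoosable.extend (hG' ▸ deleteEdges_le _) hG fun R hR => ?_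
  have hadj : ∀ u w, G'.Adj u w ↔ G.Adj u w ∧ ∀ i, x i ≠ u ∧ x i ≠ w := by
    intro u w
    simp [hG', deleteEdges_adj]
  have hd0 : ∀ i, G'.degree (x i) = 0 := by
    intro i
    rw [← card_neighborFinset_eq_degree, Finset.card_eq_zero, Finset.eq_empty_iff_forall_notMem]
    intro w hw
    rw [mem_neighborFinset, hadj] at hw
    exact (hw.2 i).1 rfl
  have hdw : ∀ w, G'.degree w + (Finset.univ.filter fun j => G.Adj (x j) w).card ≤ G.degree w := by
    intro w
    rw [← card_neighborFinset_eq_degree, ← card_neighborFinset_eq_degree,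
      ← Finset.card_image_of_injective _ hinj, ← Finset.card_union_of_disjoint]
    · apply Finset.card_le_card
      intro u hu
      simp only [Finset.mem_union, mem_neighborFinset, Finset.mem_image, Finset.mem_filter,
        Finset.mem_univ, true_and] at hu ⊢
      rcases hu with hu | ⟨j, hj, rfl⟩
      · exact ((hadj _ _).1 hu).1
      · exact hj.symm
    · rw [Finset.disjoint_left]
      intro u hu hu'
      simp only [mem_neighborFinset, Finset.mem_image, Finset.mem_filter,
        Finset.mem_univ, true_and] at hu hu'
      obtain ⟨j, -, rfl⟩ := hu'
      exact (((hadj _ _).1 hu).2 j).2 rfl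
  -- Rows are the stable vertices and columns are all vertices. An edge `x i w` loses no colours at
  -- `x i`, where `G'` has degree `0`, and at `w` only those of edges to vertices outside the stable
  -- set.
  set F : Finset (ι × V) := Finset.univ.filter fun e => G.Adj (x e.1) e.2 with hF
  have hmF : ∀ i w, (i, w) ∈ F ↔ G.Adj (x i) w := by simp [hF]
  have hH : ∀ i w, G.Adj (x i) w → (G \ G').Adj (x i) w := by
    intro i w h
    rw [sdiff_adj, hadj]
    exact ⟨h, fun h' => (h'.2 i).1 rfl⟩
  obtain ⟨c, hc1, hc2, hc3⟩ := exists_colouring_of_card_lt r q F (fun i w => R s(x i, w))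
    (fun i w w' h h' => hr i w w' ((hmF _ _).1 h) ((hmF _ _).1 h'))
    (fun i j w h h' => hq i j w ((hmF _ _).1 h) ((hmF _ _).1 h')) (by
      intro i w h
      rw [hmF] at h
      have h1 : (F.filter fun e => e.1 = i ∧ r i e.2 < r i w).card ≤ r i w := by
        rw [← Finset.filter_filter]
        refine card_filter_lt_le (F.filter fun e => e.1 = i) (fun e => r i e.2) ?_ _
        rintro ⟨j, u⟩ hu ⟨j', u'⟩ hu' he
        simp only [Finset.coe_filter, Set.mem_ofPred_eq, hmF] at hu hu'
        obtain ⟨hu, rfl⟩ := hu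
        obtain ⟨hu', rfl⟩ := hu'
        rw [hr _ _ _ hu hu' he]
      have h2 : (F.filter fun e => e.2 = w ∧ q e.1 w < q i w).card ≤ q i w := by
        rw [← Finset.filter_filter]
        refine card_filter_lt_le (F.filter fun e => e.2 = w) (fun e => q e.1 w) ?_ _
        rintro ⟨j, u⟩ hu ⟨j', u'⟩ hu' he
        simp only [Finset.coe_filter, Set.mem_ofPred_eq, hmF] at hu hu'
        obtain ⟨hu, rfl⟩ := hu
        obtain ⟨hu', rfl⟩ := hu'
        rw [hq _ _ _ hu hu' he]
      have h3 := hb i w h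
      have h4 := hdw w
      have h5 := hR _ _ (hH i w h)
      rw [hd0] at h5
      omega)
  -- Stability makes the cell of an edge unique: an edge with both ends among the `x i` would belong
  -- to two cells.
  set C : Sym2 V → ℕ := fun e => if h : ∃ p : ι × V, p ∈ F ∧ e = s(x p.1, p.2)
    then c h.choose.1 h.choose.2 else 0 with hC
  have hCe : ∀ i w, G.Adj (x i) w → C s(x i, w) = c i w := by
    intro i w h
    have hex : ∃ p : ι × V, p ∈ F ∧ s(x i, w) = s(x p.1, p.2) := ⟨(i, w), (hmF _ _).2 h, rfl⟩
    have hspec := hex.choose_spec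
    have hp : hex.choose = (i, w) := by
      generalize hex.choose = p at hspec
      obtain ⟨j, u⟩ := p
      obtain ⟨hm, he⟩ := hspec
      rw [Sym2.eq_iff] at he
      rcases he with ⟨h1, h2⟩ | ⟨h1, h2⟩
      · rw [hinj h1, h2]
      · simp only at h2
        subst h2
        exact absurd h (hst i j)
    simp only [hC]
    rw [dif_pos hex, hp]
  have hend : ∀ u w, (G \ G').Adj u w → (∃ i, x i = u) ∨ ∃ i, x i = w := by
    intro u w h
    rw [sdiff_adj, hadj] at h
    by_contra! hne
    exact h.2 ⟨h.1, fun i => ⟨hne.1 i, hne.2 i⟩⟩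
  have hle : ∀ u w, (G \ G').Adj u w → G.Adj u w := fun u w h => ((sdiff_adj ..).1 h).1
  refine ⟨C, ?_, ?_⟩
  · intro u w h
    rcases hend u w h with ⟨i, rfl⟩ | ⟨i, rfl⟩
    · rw [hCe i w (hle _ _ h)]
      exact hc1 i w ((hmF _ _).2 (hle _ _ h))
    · rw [Sym2.eq_swap, hCe i u (hle _ _ h).symm]
      exact hc1 i u ((hmF _ _).2 (hle _ _ h).symm)
  · intro u v w hv hw heq
    have hv' := hle _ _ hv
    have hw' := hle _ _ hw
    by_cases hu : ∃ i, x i = u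
    · obtain ⟨i, rfl⟩ := hu
      rw [hCe i v hv', hCe i w hw'] at heq
      exact hc2 i v w ((hmF _ _).2 hv') ((hmF _ _).2 hw') heq
    · obtain ⟨i, rfl⟩ := (hend u v hv).resolve_left hu
      obtain ⟨j, rfl⟩ := (hend u w hw).resolve_left hu
      rw [Sym2.eq_swap, hCe i u hv'.symm, Sym2.eq_swap, hCe j u hw'.symm] at heq
      rw [hc3 i j u ((hmF _ _).2 hv'.symm) ((hmF _ _).2 hw'.symm) heq]

end

/-- A colouring of a graph whose edges are listed explicitly. -/
theorem listColourable_of_edges {V ι κ : Type*} {H : SimpleGraph V} {R : Sym2 V → Finset ℕ}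
    (p : κ → V) (hp : Function.Injective p) (a b : ι → κ) (c : ι → ℕ)
    (hH : ∀ u w, H.Adj u w → ∃ i, s(u, w) = s(p (a i), p (b i)))
    (hc : ∀ i, c i ∈ R s(p (a i), p (b i)))
    (hne : ∀ i j, i ≠ j → (a i = a j ∨ a i = b j ∨ b i = a j ∨ b i = b j) → c i ≠ c j) :
    H.ListColourable R := by
  classical
  refine ⟨fun e => if h : ∃ i, e = s(p (a i), p (b i)) then c h.choose else 0, ?_, ?_⟩
  · intro u w h
    have hex := hH u w h
    simp only [dif_pos hex]
    have := hc hex.choose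
    rwa [← hex.choose_spec] at this
  · intro u v w hv hw heq
    have hex := hH u v hv
    have hex' := hH u w hw
    simp only [dif_pos hex, dif_pos hex'] at heq
    have h1 := hex.choose_spec
    have h2 := hex'.choose_spec
    generalize hex.choose = i at *
    generalize hex'.choose = j at *
    by_cases hij : i = j
    · subst hij
      rw [← h1] at h2
      exact (Sym2.congr_right.1 h2).symm
    · refine absurd heq (hne i j hij ?_)
      have hu : u ∈ s(p (a i), p (b i)) := h1 ▸ Sym2.mem_mk_left _ _
      have hu' : u ∈ s(p (a j), p (b j)) := h2 ▸ Sym2.mem_mk_left _ _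
      rw [Sym2.mem_iff] at hu hu'
      rcases hu with hu | hu <;> rcases hu' with hu' | hu' <;> have := hp (hu.symm.trans hu') <;>
        tauto

/-! ### The wheel with four spokes -/

theorem exists_mem_ne {S : Finset ℕ} (hS : 2 ≤ S.card) (a : ℕ) : ∃ z ∈ S, z ≠ a := by
  obtain ⟨z, hz, h⟩ := Finset.exists_mem_notMem_of_card_lt_card (s := {a}) (t := S) (by simp; omega)
  exact ⟨z, hz, by simpa using h⟩

theorem exists_mem_ne_ne {S : Finset ℕ} (hS : 3 ≤ S.card) (a b : ℕ) :
    ∃ z ∈ S, z ≠ a ∧ z ≠ b := by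
  obtain ⟨z, hz, h⟩ := Finset.exists_mem_notMem_of_card_lt_card (s := {a, b}) (t := S)
    (Finset.card_le_two.trans_lt hS)
  exact ⟨z, hz, by simpa using h⟩

/-- A 4-cycle is colourable from lists of size two. -/
theorem exists_colouring_four_cycle {A B C D : Finset ℕ} (hA : A.card = 2) (hB : B.card = 2)
    (hC : C.card = 2) (hD : D.card = 2) :
    ∃ a ∈ A, ∃ b ∈ B, ∃ c ∈ C, ∃ d ∈ D, a ≠ b ∧ b ≠ c ∧ c ≠ d ∧ d ≠ a := by
  -- A colour of `A` missing from `D` lets the greedy colouring close up. Otherwise, after rotation,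
  -- the four lists coincide and two colours alternate.
  have key : ∀ {A B C D : Finset ℕ}, 2 ≤ B.card → 2 ≤ C.card → 2 ≤ D.card → ¬ A ⊆ D →
      ∃ a ∈ A, ∃ b ∈ B, ∃ c ∈ C, ∃ d ∈ D, a ≠ b ∧ b ≠ c ∧ c ≠ d ∧ d ≠ a := by
    intro A B C D hB hC hD h
    obtain ⟨a, ha, haD⟩ := Finset.not_subset.1 h
    obtain ⟨b, hb, hab⟩ := exists_mem_ne hB a
    obtain ⟨c, hc, hbc⟩ := exists_mem_ne hC b
    obtain ⟨d, hd, hcd⟩ := exists_mem_ne hD c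
    exact ⟨a, ha, b, hb, c, hc, d, hd, hab.symm, hbc.symm, hcd.symm, fun h => haD (h ▸ hd)⟩
  by_cases h1 : A ⊆ D
  · by_cases h2 : D ⊆ C
    · by_cases h3 : C ⊆ B
      · have e1 := Finset.eq_of_subset_of_card_le h1 (by omega)
        have e2 := Finset.eq_of_subset_of_card_le h2 (by omega)
        have e3 := Finset.eq_of_subset_of_card_le h3 (by omega)
        subst e1 e2 e3
        obtain ⟨x, y, hxy, rfl⟩ := Finset.card_eq_two.1 hA
        exact ⟨x, by simp, y, by simp, x, by simp, y, by simp, hxy, hxy.symm, hxy, hxy.symm⟩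
      · obtain ⟨c, hc, d, hd, a, ha, b, hb, h⟩ := key (A := C) (B := D) (C := A) (D := B)
          (by omega) (by omega) (by omega) h3
        exact ⟨a, ha, b, hb, c, hc, d, hd, by tauto⟩
    · obtain ⟨d, hd, a, ha, b, hb, c, hc, h⟩ := key (A := D) (B := A) (C := B) (D := C)
        (by omega) (by omega) (by omega) h2
      exact ⟨a, ha, b, hb, c, hc, d, hd, by tauto⟩
  · exact key (by omega) (by omega) (by omega) h1

/-- This completes a wheel colouring in which the disjoint edges `vb` and `ax₁` share the colour
`β`. Sharing merges constraints, so choosing `α`, `a`, `b'`, `b` greedily in this order succeeds. -/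
theorem exists_extension_of_common {P A₂ B₁ B₂ : Finset ℕ} (hP : P.card = 2) (hA₂ : A₂.card = 3)
    (hB₁ : B₁.card = 3) (hB₂ : B₂.card = 3) (β : ℕ) :
    ∃ α ∈ P, ∃ a ∈ A₂, ∃ b ∈ B₁, ∃ b' ∈ B₂, α ≠ β ∧ a ≠ α ∧ a ≠ β ∧ b ≠ β ∧ b' ≠ β ∧ b ≠ b' ∧
      a ≠ b' := by
  obtain ⟨α, hα, h1⟩ := exists_mem_ne hP.ge β
  obtain ⟨a, ha, h2, h3⟩ := exists_mem_ne_ne hA₂.ge α β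
  obtain ⟨b', hb', h4, h5⟩ := exists_mem_ne_ne hB₂.ge β a
  obtain ⟨b, hb, h6, h7⟩ := exists_mem_ne_ne hB₁.ge β b'
  exact ⟨α, hα, a, ha, b, hb, b', hb', h1, h2, h3, h6, h4, h7, h5.symm⟩

/-- This completes a wheel colouring in which `ax₁` has the colour `γ`. If `Q ⊆ B₁`, both colours of
`Q` are used, on `vb` and on `bx₁`. Otherwise some `β ∈ Q` cannot conflict with `bx₁`, and the rest
is greedy. -/
theorem exists_extension_of_disjoint {P Q A₂ B₁ B₂ : Finset ℕ} (hP : P.card = 2) (hQ : Q.card = 2)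
    (hA₂ : A₂.card = 3) (hB₁ : B₁.card = 3) (hB₂ : B₂.card = 3) (hPQ : Disjoint P Q)
    {γ : ℕ} (hγP : γ ∉ P) (hγQ : γ ∉ Q) :
    ∃ α ∈ P, ∃ β ∈ Q, ∃ a ∈ A₂, ∃ b ∈ B₁, ∃ b' ∈ B₂, α ≠ β ∧ α ≠ γ ∧ α ≠ a ∧ β ≠ b ∧ β ≠ b' ∧
      γ ≠ a ∧ b ≠ b' ∧ γ ≠ b ∧ a ≠ b' := by
  have hne : ∀ α ∈ P, ∀ β ∈ Q, α ≠ β := fun α hα β hβ h =>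
    Finset.disjoint_left.1 hPQ hα (h ▸ hβ)
  by_cases hQB : Q ⊆ B₁
  · obtain ⟨q, q', hqq, rfl⟩ := Finset.card_eq_two.1 hQ
    obtain ⟨b', hb', h1, h2⟩ := exists_mem_ne_ne hB₂.ge q q'
    obtain ⟨a, ha, h3, h4⟩ := exists_mem_ne_ne hA₂.ge γ b'
    obtain ⟨α, hα, h5⟩ := exists_mem_ne hP.ge a
    exact ⟨α, hα, q, by simp, a, ha, q', hQB (by simp), b', hb', hne α hα q (by simp),
      fun h => hγP (h ▸ hα), h5, hqq, h1.symm, h3.symm, h2.symm, fun h => hγQ (by simp [h]), h4⟩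
  · obtain ⟨β, hβ, hβB⟩ := Finset.not_subset.1 hQB
    obtain ⟨α, hα⟩ : P.Nonempty := Finset.card_pos.1 (by omega)
    obtain ⟨a, ha, h1, h2⟩ := exists_mem_ne_ne hA₂.ge α γ
    obtain ⟨b', hb', h3, h4⟩ := exists_mem_ne_ne hB₂.ge β a
    obtain ⟨b, hb, h5, h6⟩ := exists_mem_ne_ne hB₁.ge γ b'
    exact ⟨α, hα, β, hβ, a, ha, b, hb, b', hb', hne α hα β hβ, fun h => hγP (h ▸ hα), h1.symm,
      fun h => hβB (h ▸ hb), h3.symm, h2.symm, h6, h5.symm, h4.symm⟩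

/-- The wheel with four spokes is edge-colourable from lists of certain sizes: the hub `v` is joined to
`a`, `b`, `x₁`, `x₂`, and both `a` and `b` are joined to `x₁` and `x₂`. -/
theorem exists_colouring_wheel_of_card_eq {P Q A₁ A₂ B₁ B₂ X₁ X₂ : Finset ℕ}
    (hP : P.card = 2) (hQ : Q.card = 2) (hA₁ : A₁.card = 3) (hA₂ : A₂.card = 3)
    (hB₁ : B₁.card = 3) (hB₂ : B₂.card = 3) (hX₁ : X₁.card = 5) (hX₂ : X₂.card = 5) :
    ∃ α ∈ P, ∃ β ∈ Q, ∃ a₁ ∈ A₁, ∃ a₂ ∈ A₂, ∃ b₁ ∈ B₁, ∃ b₂ ∈ B₂, ∃ x₁ ∈ X₁, ∃ x₂ ∈ X₂,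
      (α ≠ β ∧ α ≠ a₁ ∧ α ≠ a₂ ∧ β ≠ b₁ ∧ β ≠ b₂ ∧ a₁ ≠ a₂ ∧ b₁ ≠ b₂ ∧ a₁ ≠ b₁ ∧ a₂ ≠ b₂) ∧
      (x₁ ≠ α ∧ x₁ ≠ β ∧ x₁ ≠ a₁ ∧ x₁ ≠ b₁) ∧ (x₂ ≠ α ∧ x₂ ≠ β ∧ x₂ ≠ a₂ ∧ x₂ ≠ b₂) ∧
      x₁ ≠ x₂ := by
  by_contra hno
  -- Four colours are forbidden on each of two adjacent edges with lists of size five. If no choice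
  -- works, both edges have the same single colour left; so the four forbidden colours are distinct
  -- and all lie in the list.
  have sub : ∀ {X X' : Finset ℕ} {α β a b α' β' a' b' : ℕ}, X.card = 5 → X'.card = 5 →
      (∀ x ∈ X, ∀ x' ∈ X', (x ≠ α ∧ x ≠ β ∧ x ≠ a ∧ x ≠ b) →
        (x' ≠ α' ∧ x' ≠ β' ∧ x' ≠ a' ∧ x' ≠ b') → x = x') →
      ({α, β, a, b} ⊆ X ∧ α ≠ b ∧ β ≠ a) ∧
        ∀ z ∈ X, (z ≠ α ∧ z ≠ β ∧ z ≠ a ∧ z ≠ b) →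
          z ∈ X' ∧ z ≠ α' ∧ z ≠ β' ∧ z ≠ a' ∧ z ≠ b' := by
    intro X X' α β a b α' β' a' b' hX hX' h
    obtain ⟨x', hx', hx'n⟩ := Finset.exists_mem_notMem_of_card_lt_card (s := {α', β', a', b'})
      (t := X') (Finset.card_le_four.trans_lt (by omega))
    simp only [Finset.mem_insert, Finset.mem_singleton, not_or] at hx'n
    have hY : (X \ {α, β, a, b}).card ≤ 1 := by
      rw [Finset.card_le_one]
      intro z hz z' hz'
      simp only [Finset.mem_sdiff, Finset.mem_insert, Finset.mem_singleton, not_or] at hz hz'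
      rw [h z hz.1 x' hx' hz.2 hx'n, h z' hz'.1 x' hx' hz'.2 hx'n]
    have hc := Finset.card_sdiff_add_card_inter X {α, β, a, b}
    have hi : (X ∩ {α, β, a, b}) = {α, β, a, b} :=
      Finset.eq_of_subset_of_card_le Finset.inter_subset_right
        (Finset.card_le_four.trans (by omega))
    have h4 : 4 ≤ ({α, β, a, b} : Finset ℕ).card := by rw [hi] at hc; omega
    refine ⟨⟨Finset.inter_eq_right.1 hi, ?_, ?_⟩, fun z hz hzn => ?_⟩
    · rintro rfl
      have : ({α, β, a, α} : Finset ℕ) = {α, β, a} := by ext; simp; tauto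
      rw [this] at h4
      exact absurd (h4.trans Finset.card_le_three) (by omega)
    · rintro rfl
      have : ({α, β, β, b} : Finset ℕ) = {α, β, b} := by ext; simp
      rw [this] at h4
      exact absurd (h4.trans Finset.card_le_three) (by omega)
    · rw [h z hz x' hx' hzn hx'n]
      exact ⟨hx', hx'n⟩
  -- Consequence for every proper colouring of the six edges other than `vx₁` and `vx₂`, as none of
  -- them extends.
  have bad : ∀ α ∈ P, ∀ β ∈ Q, ∀ a₁ ∈ A₁, ∀ a₂ ∈ A₂, ∀ b₁ ∈ B₁, ∀ b₂ ∈ B₂,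
      (α ≠ β ∧ α ≠ a₁ ∧ α ≠ a₂ ∧ β ≠ b₁ ∧ β ≠ b₂ ∧ a₁ ≠ a₂ ∧ b₁ ≠ b₂ ∧ a₁ ≠ b₁ ∧ a₂ ≠ b₂) →
      (({α, β, a₁, b₁} ⊆ X₁ ∧ α ≠ b₁ ∧ β ≠ a₁) ∧ ({α, β, a₂, b₂} ⊆ X₂ ∧ α ≠ b₂ ∧ β ≠ a₂)) ∧
        ∀ z ∈ X₁, (z ≠ α ∧ z ≠ β ∧ z ≠ a₁ ∧ z ≠ b₁) →
          z ∈ X₂ ∧ z ≠ α ∧ z ≠ β ∧ z ≠ a₂ ∧ z ≠ b₂ := by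
    intro α hα β hβ a₁ ha₁ a₂ ha₂ b₁ hb₁ b₂ hb₂ hp
    have hx : ∀ x ∈ X₁, ∀ x' ∈ X₂, (x ≠ α ∧ x ≠ β ∧ x ≠ a₁ ∧ x ≠ b₁) →
        (x' ≠ α ∧ x' ≠ β ∧ x' ≠ a₂ ∧ x' ≠ b₂) → x = x' := by
      intro x hx x' hx' h h'
      by_contra hne
      exact hno ⟨α, hα, β, hβ, a₁, ha₁, a₂, ha₂, b₁, hb₁, b₂, hb₂, x, hx, x', hx', hp, h, h', hne⟩
    have h1 := sub hX₁ hX₂ hx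
    have h2 := sub hX₂ hX₁ fun x hx1 x' hx2 h h' => (hx x' hx2 x hx1 h' h).symm
    exact ⟨⟨h1.1, h2.1⟩, h1.2⟩
  -- A common colour of two disjoint edges meeting the same `vxᵢ` would make the forbidden colours
  -- there not distinct. Four such pairs give four disjointness statements.
  have hQA₁ : ∀ β ∈ Q, β ∉ A₁ := by
    intro β hβ h
    obtain ⟨α, hα, a, ha, b, hb, b', hb', h1, h2, h3, h4, h5, h6, h7⟩ := exists_extension_of_common hP hA₂ hB₁ hB₂ β
    exact (bad α hα β hβ β h a ha b hb b' hb' 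
        ⟨h1, h1, h2.symm, h4.symm, h5.symm, h3.symm, h6, h4.symm, h7⟩).1.1.2.2 rfl
  have hQA₂ : ∀ β ∈ Q, β ∉ A₂ := by
    intro β hβ h
    obtain ⟨α, hα, a, ha, b, hb, b', hb', h1, h2, h3, h4, h5, h6, h7⟩ := exists_extension_of_common hP hA₁ hB₂ hB₁ β
    exact (bad α hα β hβ a ha β h b' hb' b hb 
        ⟨h1, h2.symm, h1, h5.symm, h4.symm, h3, h6.symm, h7, h4.symm⟩).1.2.2.2 rfl
  have hPB₁ : ∀ α ∈ P, α ∉ B₁ := by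
    intro α hα h
    obtain ⟨β, hβ, b, hb, a, ha, a', ha', h1, h2, h3, h4, h5, h6, h7⟩ := exists_extension_of_common hQ hB₂ hA₁ hA₂ α
    exact (bad α hα β hβ a ha a' ha' α h b hb 
        ⟨h1.symm, h4.symm, h5.symm, h1, h2.symm, h6, h3.symm, h4, h7.symm⟩).1.1.2.1 rfl
  have hPB₂ : ∀ α ∈ P, α ∉ B₂ := by
    intro α hα h
    obtain ⟨β, hβ, b, hb, a, ha, a', ha', h1, h2, h3, h4, h5, h6, h7⟩ := exists_extension_of_common hQ hB₁ hA₂ hA₁ α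
    exact (bad α hα β hβ a' ha' a ha b hb α h 
        ⟨h1.symm, h5.symm, h4.symm, h2.symm, h1, h6.symm, h3, h7.symm, h4⟩).1.2.2.1 rfl
  by_cases hPQ : Disjoint P Q
  -- Any choice of `α` and `β` extends: the four other edges form a 4-cycle and retain at least two
  -- colours each.
  · have hX : ∀ α ∈ P, ∀ β ∈ Q, (α ∈ X₁ ∧ α ∈ X₂) ∧ (β ∈ X₁ ∧ β ∈ X₂) := by
      intro α hα β hβ
      have hc : ∀ {S : Finset ℕ} (c : ℕ), S.card = 3 → ∃ T ⊆ S, T.card = 2 ∧ c ∉ T := by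
        intro S c hS
        obtain ⟨T, hT, h2⟩ := Finset.exists_subset_card_eq (s := S.erase c) (n := 2)
          (by have := Finset.pred_card_le_card_erase (s := S) (a := c); omega)
        exact ⟨T, hT.trans (Finset.erase_subset _ _), h2, fun h => by simpa using hT h⟩
      obtain ⟨S₁, hS₁, c₁, n₁⟩ := hc α hA₁
      obtain ⟨S₂, hS₂, c₂, n₂⟩ := hc α hA₂
      obtain ⟨T₁, hT₁, d₁, m₁⟩ := hc β hB₁
      obtain ⟨T₂, hT₂, d₂, m₂⟩ := hc β hB₂
      obtain ⟨a₁, ha₁, a₂, ha₂, b₂, hb₂, b₁, hb₁, h⟩ := exists_colouring_four_cycle c₁ c₂ d₂ d₁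
      have hb := bad α hα β hβ a₁ (hS₁ ha₁) a₂ (hS₂ ha₂) b₁ (hT₁ hb₁) b₂ (hT₂ hb₂)
        ⟨fun h => Finset.disjoint_left.1 hPQ hα (h ▸ hβ), fun h => n₁ (h ▸ ha₁),
          fun h => n₂ (h ▸ ha₂), fun h => m₁ (h ▸ hb₁), fun h => m₂ (h ▸ hb₂), h.1, h.2.2.1.symm,
          h.2.2.2.symm, h.2.1⟩
      exact ⟨⟨hb.1.1.1 (by simp), hb.1.2.1 (by simp)⟩, hb.1.1.1 (by simp), hb.1.2.1 (by simp)⟩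
    -- If `A ⊆ X`, then `Q`, `A` and an element of `P` outside `A` would be six elements of `X`. A
    -- colour of `A` outside `X`, used on its edge, contradicts `bad`; this is how `P ⊆ A₁` and `Q ⊆
    -- B₂` follow.
    have big : ∀ {P Q A X : Finset ℕ}, P.card = 2 → Q.card = 2 → A.card = 3 → X.card = 5 →
        Disjoint P Q → P ⊆ X → Q ⊆ X → Disjoint Q A → ¬ P ⊆ A → ∃ γ ∈ A, γ ∉ X := by
      intro P Q A X hP hQ hA hX hPQ hPX hQX hQA hPA
      by_contra! hAX
      obtain ⟨p, hp, hpA⟩ := Finset.not_subset.1 hPA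
      have h1 : (insert p (Q ∪ A)).card = 6 := by
        rw [Finset.card_insert_of_notMem, Finset.card_union_of_disjoint hQA, hQ, hA]
        simp only [Finset.mem_union, not_or]
        exact ⟨Finset.disjoint_left.1 hPQ hp, hpA⟩
      have := Finset.card_le_card (Finset.insert_subset (hPX hp) (Finset.union_subset hQX hAX))
      omega
    obtain ⟨p, p', hpp, hPe⟩ := Finset.card_eq_two.1 hP
    obtain ⟨q, q', hqq, hQe⟩ := Finset.card_eq_two.1 hQ
    have hp : p ∈ P := by simp [hPe]
    have hp' : p' ∈ P := by simp [hPe]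
    have hq : q ∈ Q := by simp [hQe]
    have hq' : q' ∈ Q := by simp [hQe]
    have hPA₁ : P ⊆ A₁ := by
      by_contra h
      obtain ⟨γ, hγ, hγX⟩ := big hP hQ hA₁ hX₁ hPQ (fun α hα => (hX α hα q hq).1.1)
        (fun β hβ => (hX p hp β hβ).2.1) (Finset.disjoint_left.2 hQA₁) h
      obtain ⟨α, hα, β, hβ, a, ha, b, hb, b', hb', h1⟩ := exists_extension_of_disjoint hP hQ hA₂
        hB₁ hB₂ hPQ (γ := γ) (fun h => hγX (hX γ h q hq).1.1) (fun h => hγX (hX p hp γ h).2.1)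
      exact hγX ((bad α hα β hβ γ hγ a ha b hb b' hb' h1).1.1.1 (by simp))
    have hQB₂ : Q ⊆ B₂ := by
      by_contra h
      obtain ⟨γ, hγ, hγX⟩ := big hQ hP hB₂ hX₂ hPQ.symm (fun β hβ => (hX p hp β hβ).2.2)
        (fun α hα => (hX α hα q hq).1.2) (Finset.disjoint_left.2 hPB₂) h
      obtain ⟨β, hβ, α, hα, b, hb, a, ha, a', ha', h1, h2, h3, h4, h5, h6, h7, h8, h9⟩ := exists_extension_of_disjoint hQ hP hB₁
        hA₂ hA₁ hPQ.symm (γ := γ) (fun h => hγX (hX p hp γ h).2.2) (fun h => hγX (hX γ h q hq).1.2)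
      exact hγX ((bad α hα β hβ a' ha' a ha b hb γ hγ 
        ⟨h1.symm, h5, h4, h3, h2, h7.symm, h6.symm, h9.symm, h8.symm⟩).1.2.1 (by simp))
    obtain ⟨z, hz, hz1, hz2⟩ := exists_mem_ne_ne hA₂.ge p p'
    obtain ⟨w, hw, hw1, hw2⟩ := exists_mem_ne_ne hB₁.ge q q'
    have hpq : p ≠ q := fun h => Finset.disjoint_left.1 hPQ hp (h ▸ hq)
    have hpq' : p' ≠ q' := fun h => Finset.disjoint_left.1 hPQ hp' (h ▸ hq')
    have hpq'' : p ≠ q' := fun h => Finset.disjoint_left.1 hPQ hp (h ▸ hq')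
    have hzq : z ≠ q' := fun h => hQA₂ q' hq' (h ▸ hz)
    have hwp : p' ≠ w := fun h => hPB₁ p' hp' (h ▸ hw)
    -- The colour `q'` is free at `vx₁` but is used on `bx₂`, so the two leftover colours differ.
    have := (bad p hp q hq p' (hPA₁ hp') z hz w hw q' (hQB₂ hq')
      ⟨hpq, hpp, hz1.symm, hw1.symm, hqq, hz2.symm, hw2, hwp, hzq⟩).2 q' (hX p hp q' hq').2.1
      ⟨hpq''.symm, hqq.symm, hpq'.symm, hw2.symm⟩
    exact this.2.2.2.2 rfl
  · obtain ⟨γ, hγP, hγQ⟩ := Finset.not_disjoint_iff.1 hPQ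
    obtain ⟨β, hβ, hβγ⟩ := exists_mem_ne hQ.ge γ
    have nA₁ := hQA₁ γ hγQ
    have nA₂ := hQA₂ γ hγQ
    have nB₁ := hPB₁ γ hγP
    have nB₂ := hPB₂ γ hγP
    -- With `γ` on `va`, the lists at `a` lose nothing. Every colour of `Aᵢ` can then be used, so
    -- `Xᵢ` consists of exactly `γ`, `β` and `Aᵢ`.
    have heq : ∀ {A X : Finset ℕ}, A.card = 3 → X.card = 5 → γ ∈ X → β ∈ X → γ ∉ A → β ∉ A →
        A ⊆ X → ∀ z, z ∈ X → z ≠ γ → z ≠ β → z ∈ A := by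
      intro A X hA hX hγ hβ nγ nβ hAX z hz h1 h2
      by_contra h3
      have h4 : (insert z (insert γ (insert β A))).card = 6 := by
        rw [Finset.card_insert_of_notMem (by simp [*]),
          Finset.card_insert_of_notMem (by simp [*, hβγ.symm]),
          Finset.card_insert_of_notMem nβ, hA]
      have := Finset.card_le_card (Finset.insert_subset hz (Finset.insert_subset hγ
        (Finset.insert_subset hβ hAX)))
      omega
    have memA : ∀ {z : ℕ} {A : Finset ℕ} (y : ℕ), z ∈ A → y ∉ A → y ≠ z := fun y hz hy h =>
      hy (h ▸ hz)
    have hAX₁ : ∀ a ∈ A₁, a ∈ X₁ ∧ γ ∈ X₁ ∧ β ∈ X₁ := by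
      intro a ha
      obtain ⟨b₁, hb₁, h1, h2⟩ := exists_mem_ne_ne hB₁.ge β a
      obtain ⟨b₂, hb₂, h3, h4⟩ := exists_mem_ne_ne hB₂.ge β b₁
      obtain ⟨a₂, ha₂, h5, h6⟩ := exists_mem_ne_ne hA₂.ge a b₂
      have := (bad γ hγP β hβ a ha a₂ ha₂ b₁ hb₁ b₂ hb₂ ⟨hβγ.symm, memA γ ha nA₁, memA γ ha₂ nA₂,
        h1.symm, h3.symm, h5.symm, h4.symm, h2.symm, h6⟩).1.1.1
      exact ⟨this (by simp), this (by simp), this (by simp)⟩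
    have hAX₂ : ∀ a ∈ A₂, a ∈ X₂ ∧ γ ∈ X₂ ∧ β ∈ X₂ := by
      intro a ha
      obtain ⟨b₂, hb₂, h1, h2⟩ := exists_mem_ne_ne hB₂.ge β a
      obtain ⟨b₁, hb₁, h3, h4⟩ := exists_mem_ne_ne hB₁.ge β b₂
      obtain ⟨a₁, ha₁, h5, h6⟩ := exists_mem_ne_ne hA₁.ge a b₁
      have := (bad γ hγP β hβ a₁ ha₁ a ha b₁ hb₁ b₂ hb₂ ⟨hβγ.symm, memA γ ha₁ nA₁, memA γ ha nA₂,
        h3.symm, h1.symm, h5, h4, h6, h2.symm⟩).1.2.1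
      exact ⟨this (by simp), this (by simp), this (by simp)⟩
    obtain ⟨y₁, hy₁⟩ : A₁.Nonempty := Finset.card_pos.1 (by omega)
    obtain ⟨y₂, hy₂⟩ : A₂.Nonempty := Finset.card_pos.1 (by omega)
    have e₁ := heq hA₁ hX₁ (hAX₁ y₁ hy₁).2.1 (hAX₁ y₁ hy₁).2.2 nA₁ (hQA₁ β hβ)
      fun a ha => (hAX₁ a ha).1
    have e₂ := heq hA₂ hX₂ (hAX₂ y₂ hy₂).2.1 (hAX₂ y₂ hy₂).2.2 nA₂ (hQA₂ β hβ)
      fun a ha => (hAX₂ a ha).1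
    by_cases hAA : A₁ ⊆ A₂
    · have hAe := Finset.eq_of_subset_of_card_le hAA (by omega)
      obtain ⟨b₁, hb₁, h1⟩ := exists_mem_ne (S := B₁) (by omega) β
      obtain ⟨b₂, hb₂, h2, h3⟩ := exists_mem_ne_ne hB₂.ge β b₁
      obtain ⟨a₁, ha₁, h4⟩ := exists_mem_ne (S := A₁) (by omega) b₁
      obtain ⟨a₂, ha₂, h5, h6⟩ := exists_mem_ne_ne hA₂.ge b₂ a₁
      have hb := (bad γ hγP β hβ a₁ ha₁ a₂ ha₂ b₁ hb₁ b₂ hb₂ ⟨hβγ.symm, memA γ ha₁ nA₁,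
        memA γ ha₂ nA₂, h1.symm, h2.symm, h6.symm, h3.symm, h4, h5⟩).1
      have hbA₁ : b₁ ∈ A₁ := e₁ b₁ (hb.1.1 (by simp)) (memA γ hb₁ nB₁).symm h1
      have hbA₂ : b₂ ∈ A₁ := hAe ▸ e₂ b₂ (hb.2.1 (by simp)) (memA γ hb₂ nB₂).symm h2
      -- Here `A₁ = A₂ = {b₁, b₂, z}`. With `b₂` on `ax₁` and `z` on `ax₂`, the colour left at `vx₁`
      -- is `z`, which is forbidden at `vx₂`.
      obtain ⟨z, hz, h7, h8⟩ := exists_mem_ne_ne hA₂.ge b₁ b₂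
      have hfin := (bad γ hγP β hβ b₂ hbA₂ z hz b₁ hb₁ b₂ hb₂ ⟨hβγ.symm, memA γ hb₂ nB₂,
        memA γ hz nA₂, h1.symm, h2.symm, h8.symm, h3.symm, h3, h8⟩).2
      have := (hfin z (hAX₁ z (hAe ▸ hz)).1 ⟨(memA γ hz nA₂).symm, fun h => hQA₂ β hβ (h ▸ hz),
        h8, h7⟩).2.2.2.1
      exact this rfl
    -- Leave `s ∈ A₁ \ A₂` unused at `x₁`. It is then the colour left at `vx₁`, so it must lie in
    -- `X₂` and hence in `A₂`.
    · obtain ⟨s, hs, hs'⟩ := Finset.not_subset.1 hAA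
      obtain ⟨b₁, hb₁, h1, h2⟩ := exists_mem_ne_ne hB₁.ge β s
      obtain ⟨a₁, ha₁, h3, h4⟩ := exists_mem_ne_ne hA₁.ge b₁ s
      obtain ⟨b₂, hb₂, h5, h6⟩ := exists_mem_ne_ne hB₂.ge β b₁
      obtain ⟨a₂, ha₂, h7, h8⟩ := exists_mem_ne_ne hA₂.ge b₂ a₁
      have hsβ : s ≠ β := fun h => hQA₁ β hβ (h ▸ hs)
      have hfin := (bad γ hγP β hβ a₁ ha₁ a₂ ha₂ b₁ hb₁ b₂ hb₂ ⟨hβγ.symm, memA γ ha₁ nA₁,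
        memA γ ha₂ nA₂, h1.symm, h5.symm, h8.symm, h6.symm, h3, h7⟩).2 s (hAX₁ s hs).1
        ⟨(memA γ hs nA₁).symm, hsβ, h4.symm, h2.symm⟩
      exact hs' (e₂ s hfin.1 hfin.2.1 hsβ)

theorem exists_colouring_wheel {P Q A₁ A₂ B₁ B₂ X₁ X₂ : Finset ℕ}
    (hP : 2 ≤ P.card) (hQ : 2 ≤ Q.card) (hA₁ : 3 ≤ A₁.card) (hA₂ : 3 ≤ A₂.card)
    (hB₁ : 3 ≤ B₁.card) (hB₂ : 3 ≤ B₂.card) (hX₁ : 5 ≤ X₁.card) (hX₂ : 5 ≤ X₂.card) :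
    ∃ α ∈ P, ∃ β ∈ Q, ∃ a₁ ∈ A₁, ∃ a₂ ∈ A₂, ∃ b₁ ∈ B₁, ∃ b₂ ∈ B₂, ∃ x₁ ∈ X₁, ∃ x₂ ∈ X₂,
      (α ≠ β ∧ α ≠ a₁ ∧ α ≠ a₂ ∧ β ≠ b₁ ∧ β ≠ b₂ ∧ a₁ ≠ a₂ ∧ b₁ ≠ b₂ ∧ a₁ ≠ b₁ ∧ a₂ ≠ b₂) ∧
      (x₁ ≠ α ∧ x₁ ≠ β ∧ x₁ ≠ a₁ ∧ x₁ ≠ b₁) ∧ (x₂ ≠ α ∧ x₂ ≠ β ∧ x₂ ≠ a₂ ∧ x₂ ≠ b₂) ∧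
      x₁ ≠ x₂ := by
  obtain ⟨P', sP, cP⟩ := Finset.exists_subset_card_eq hP
  obtain ⟨Q', sQ, cQ⟩ := Finset.exists_subset_card_eq hQ
  obtain ⟨A₁', sA₁, cA₁⟩ := Finset.exists_subset_card_eq hA₁
  obtain ⟨A₂', sA₂, cA₂⟩ := Finset.exists_subset_card_eq hA₂
  obtain ⟨B₁', sB₁, cB₁⟩ := Finset.exists_subset_card_eq hB₁
  obtain ⟨B₂', sB₂, cB₂⟩ := Finset.exists_subset_card_eq hB₂
  obtain ⟨X₁', sX₁, cX₁⟩ := Finset.exists_subset_card_eq hX₁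
  obtain ⟨X₂', sX₂, cX₂⟩ := Finset.exists_subset_card_eq hX₂
  obtain ⟨α, hα, β, hβ, a₁, ha₁, a₂, ha₂, b₁, hb₁, b₂, hb₂, x₁, hx₁, x₂, hx₂, h⟩ :=
    exists_colouring_wheel_of_card_eq cP cQ cA₁ cA₂ cB₁ cB₂ cX₁ cX₂
  exact ⟨α, sP hα, β, sQ hβ, a₁, sA₁ ha₁, a₂, sA₂ ha₂, b₁, sB₁ hb₁, b₂, sB₂ hb₂, x₁, sX₁ hx₁, x₂,
    sX₂ hx₂, h⟩

/-! ### The Alon–Tarsi theorem -/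

/-- The coefficient at the monomial with exponents `t` of the product of the differences
`X i - X j` over the pairs `(i, j)` in a list. -/
def diffProdCoeff {ι : Type*} [DecidableEq ι] : List (ι × ι) → (ι → ℕ) → ℤ
  | [], _ => 1
  | e :: l, t =>
    (if t e.1 = 0 then 0 else diffProdCoeff l (Function.update t e.1 (t e.1 - 1))) -
    (if t e.2 = 0 then 0 else diffProdCoeff l (Function.update t e.2 (t e.2 - 1)))

/-- Multiplication by `X j` shifts coefficients by one in the exponent of `j`, so expanding the
first factor gives the recursion. The degree condition ensures that the empty product is evaluated
at the constant monomial. -/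
theorem coeff_prod_X_sub_X {ι : Type*} [Fintype ι] [DecidableEq ι] (l : List (ι × ι)) (t : ι → ℕ)
    (ht : ∑ i, t i = l.length) :
    MvPolynomial.coeff (Finsupp.equivFunOnFinite.symm t)
      ((l.map fun e => (MvPolynomial.X e.1 - MvPolynomial.X e.2 : MvPolynomial ι ℤ)).prod) =
      diffProdCoeff l t := by
  induction l generalizing t with
  | nil =>
    have h0 : t = 0 := by
      ext i
      simpa using (Finset.sum_eq_zero_iff.1 ht) i (Finset.mem_univ i)
    subst h0
    simp [diffProdCoeff, MvPolynomial.coeff_one, Finsupp.ext_iff]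
  | cons e l ih =>
    have hstep : ∀ j, MvPolynomial.coeff (Finsupp.equivFunOnFinite.symm t) (MvPolynomial.X j *
        (l.map fun e => (MvPolynomial.X e.1 - MvPolynomial.X e.2 : MvPolynomial ι ℤ)).prod) =
        if t j = 0 then 0 else diffProdCoeff l (Function.update t j (t j - 1)) := by
      intro j
      rw [MvPolynomial.coeff_X_mul']
      by_cases hj : t j = 0
      · simp [hj]
      · have hupd : Finsupp.equivFunOnFinite.symm t - Finsupp.single j 1 =
            Finsupp.equivFunOnFinite.symm (Function.update t j (t j - 1)) := by
          ext i
          by_cases hij : i = j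
          · subst hij; simp
          · simp [hij]
        have hsum : ∑ i, Function.update t j (t j - 1) i = l.length := by
          have h1 := Finset.sum_update_of_mem (Finset.mem_univ j) t (t j - 1)
          have h2 := Finset.sum_eq_add_sum_sdiff_singleton_of_mem (Finset.mem_univ j) t
          simp only [List.length_cons] at ht
          omega
        rw [if_pos (by simpa using hj), if_neg hj, hupd, ih _ hsum]
    rw [List.map_cons, List.prod_cons, sub_mul, MvPolynomial.coeff_sub, hstep, hstep, diffProdCoeff]

/-- The theorem of Alon and Tarsi on colourings from lists. -/
theorem exists_colouring_of_diffProdCoeff_ne_zero {ι : Type*} [Fintype ι] [DecidableEq ι]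
    (l : List (ι × ι)) (t : ι → ℕ) (ht : ∑ i, t i = l.length) (h : diffProdCoeff l t ≠ 0)
    (S : ι → Finset ℕ) (hS : ∀ i, t i < (S i).card) :
    ∃ c : ι → ℕ, (∀ i, c i ∈ S i) ∧ ∀ e ∈ l, c e.1 ≠ c e.2 := by
  rw [← coeff_prod_X_sub_X l t ht] at h
  have hdeg : (Finsupp.equivFunOnFinite.symm t).degree = l.length := by
    rw [← ht, Finsupp.degree_eq_sum]
    simp
  obtain ⟨s, hs, he⟩ := MvPolynomial.combinatorial_nullstellensatz_exists_eval_nonzero _ _ h (by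
    apply le_antisymm
    · rw [hdeg]
      refine (MvPolynomial.totalDegree_list_prod _).trans ?_
      rw [List.map_map]
      refine (List.sum_le_card_nsmul _ 1 ?_).trans (by simp)
      intro n hn
      obtain ⟨e, -, rfl⟩ := List.mem_map.1 hn
      refine (MvPolynomial.totalDegree_sub _ _).trans ?_
      simp
    · exact MvPolynomial.le_totalDegree (MvPolynomial.mem_support_iff.2 h))
    (fun i => (S i).image Nat.cast)
    (fun i => by
      rw [Finset.card_image_of_injective _ Nat.cast_injective]
      simpa using hS i)
  have hs' : ∀ i, ∃ n ∈ S i, (n : ℤ) = s i := fun i => by simpa using hs i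
  choose c hc hcs using hs'
  refine ⟨c, hc, fun e he' heq => he ?_⟩
  rw [map_list_prod, List.prod_eq_zero_iff, List.map_map]
  exact List.mem_map.2 ⟨e, he', by simp [← hcs, heq]⟩

/-! ### Reducible wheels -/

open scoped Classical in
/-- A subgraph with explicitly listed edges is reducible if it is colourable from suitably large
lists. -/
theorem FinChoosable.of_edges {V : Type*} [Fintype V] {G : SimpleGraph V} {k : ℕ} {ι κ : Type*}
    [Fintype κ] (p : κ → V) (hp : Function.Injective p) (a b : ι → κ)
    (hG : (G.deleteEdges {e | ∃ i, e = s(p (a i), p (b i))}).FinChoosable k)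
    (hadj : ∀ i, G.Adj (p (a i)) (p (b i))) (f : ι → ℕ) (d : κ → ℕ)
    (hd : ∀ x, d x ≤ (Finset.univ.filter fun y => ∃ i, (a i = x ∧ b i = y) ∨
      (b i = x ∧ a i = y)).card)
    (hf : ∀ i, f i + G.degree (p (a i)) + G.degree (p (b i)) ≤ k + d (a i) + d (b i))
    (hc : ∀ S : ι → Finset ℕ, (∀ i, f i ≤ (S i).card) → ∃ c : ι → ℕ, (∀ i, c i ∈ S i) ∧
      ∀ i j, i ≠ j → (a i = a j ∨ a i = b j ∨ b i = a j ∨ b i = b j) → c i ≠ c j) :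
    G.FinChoosable k := by
  obtain ⟨G', hG'⟩ : ∃ G', G' = G.deleteEdges {e | ∃ i, e = s(p (a i), p (b i))} := ⟨_, rfl⟩
  rw [← hG'] at hG
  have hadj' : ∀ u w, G'.Adj u w ↔ G.Adj u w ∧ ¬ ∃ i, s(u, w) = s(p (a i), p (b i)) := by
    intro u w
    rw [hG', deleteEdges_adj]
    rfl
  have hdeg : ∀ x, G'.degree (p x) + d x ≤ G.degree (p x) := by
    intro x
    refine (Nat.add_le_add_left (hd x) _).trans ?_
    rw [← card_neighborFinset_eq_degree, ← card_neighborFinset_eq_degree,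
      ← Finset.card_image_of_injective _ hp, ← Finset.card_union_of_disjoint]
    · apply Finset.card_le_card
      intro u hu
      simp only [Finset.mem_union, mem_neighborFinset, Finset.mem_image, Finset.mem_filter,
        Finset.mem_univ, true_and] at hu ⊢
      rcases hu with hu | ⟨y, ⟨i, ⟨rfl, rfl⟩ | ⟨rfl, rfl⟩⟩, rfl⟩
      · exact ((hadj' _ _).1 hu).1
      · exact hadj i
      · exact (hadj i).symm
    · rw [Finset.disjoint_left]
      intro u hu hu'
      simp only [mem_neighborFinset, Finset.mem_image, Finset.mem_filter, Finset.mem_univ,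
        true_and] at hu hu'
      obtain ⟨y, ⟨i, ⟨rfl, rfl⟩ | ⟨rfl, rfl⟩⟩, rfl⟩ := hu'
      · exact ((hadj' _ _).1 hu).2 ⟨i, rfl⟩
      · exact ((hadj' _ _).1 hu).2 ⟨i, Sym2.eq_swap⟩
  have hH : ∀ u w, (G \ G').Adj u w ↔ G.Adj u w ∧ ∃ i, s(u, w) = s(p (a i), p (b i)) := by
    intro u w
    rw [sdiff_adj, hadj']
    tauto
  refine FinChoosable.extend (hG' ▸ deleteEdges_le _) hG fun R hR => ?_
  obtain ⟨c, hc1, hc2⟩ := hc (fun i => R s(p (a i), p (b i))) (by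
    intro i
    have h1 := hR _ _ ((hH _ _).2 ⟨hadj i, i, rfl⟩)
    have h2 := hdeg (a i)
    have h3 := hdeg (b i)
    have h4 := hf i
    omega)
  exact listColourable_of_edges p hp a b c (fun u w h => ((hH u w).1 h).2) hc1 hc2

theorem injective_vecCons {α : Type*} {n : ℕ} {x : α} {f : Fin n → α}
    (hx : ∀ i, x ≠ f i) (hf : Function.Injective f) : Function.Injective (Matrix.vecCons x f) := by
  intro i j h
  induction i using Fin.cases <;> induction j using Fin.cases <;>
    simp only [Matrix.cons_val_zero, Matrix.cons_val_succ] at h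
  · rfl
  · exact absurd h (hx _)
  · exact absurd h.symm (hx _)
  · rw [hf h]

-- Edges outside the wheel cost at most one colour at the hub `0`, three at `1` and `2`, and none at
-- `3` and `4`. This leaves lists of sizes `2`, `3` and `5`, as in the wheel lemma.
open scoped Classical in
theorem FinChoosable.of_two_triples {V : Type*} [Fintype V] {G : SimpleGraph V}
    (p : Fin 5 → V) (hp : Function.Injective p)
    (hadj : ∀ i, G.Adj (p (![0, 0, 1, 1, 2, 2, 0, 0] i)) (p (![1, 2, 3, 4, 3, 4, 3, 4] i)))
    (hdeg : ∀ j, G.degree (p j) ≤ ![5, 6, 6, 3, 3] j)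
    (hG : ∀ G' ≤ G, G' ≠ G → G'.FinChoosable 6) : G.FinChoosable 6 := by
  refine FinChoosable.of_edges p hp (![0, 0, 1, 1, 2, 2, 0, 0] : Fin 8 → Fin 5)
    ![1, 2, 3, 4, 3, 4, 3, 4] (hG _ (deleteEdges_le _) ?_) hadj ![2, 2, 3, 3, 3, 3, 5, 5]
    ![4, 3, 3, 3, 3] ?_ ?_ ?_
  · intro h
    have h1 := hadj 0
    rw [← h, deleteEdges_adj] at h1
    exact h1.2 ⟨0, rfl⟩
  · intro x
    convert (by decide : ∀ x, (![4, 3, 3, 3, 3] : Fin 5 → ℕ) x ≤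
      (Finset.univ.filter fun y : Fin 5 => ∃ i : Fin 8,
        ((![0, 0, 1, 1, 2, 2, 0, 0] : Fin 8 → Fin 5) i = x ∧
          (![1, 2, 3, 4, 3, 4, 3, 4] : Fin 8 → Fin 5) i = y) ∨
        ((![1, 2, 3, 4, 3, 4, 3, 4] : Fin 8 → Fin 5) i = x ∧
          (![0, 0, 1, 1, 2, 2, 0, 0] : Fin 8 → Fin 5) i = y)).card) x
  · intro i
    refine le_trans (add_le_add_three le_rfl (hdeg _) (hdeg _)) ?_
    revert i
    decide
  · intro S hS
    obtain ⟨α, hα, β, hβ, a₁, ha₁, a₂, ha₂, b₁, hb₁, b₂, hb₂, x₁, hx₁, x₂, hx₂, h⟩ :=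
      exists_colouring_wheel (hS 0) (hS 1) (hS 2) (hS 3) (hS 4) (hS 5) (hS 6) (hS 7)
    refine ⟨![α, β, a₁, a₂, b₁, b₂, x₁, x₂], ?_, ?_⟩
    · intro i
      fin_cases i <;> assumption
    · have key : ∀ i j : Fin 8, i < j →
          ((![0, 0, 1, 1, 2, 2, 0, 0] : Fin 8 → Fin 5) i = ![0, 0, 1, 1, 2, 2, 0, 0] j ∨
          (![0, 0, 1, 1, 2, 2, 0, 0] : Fin 8 → Fin 5) i = ![1, 2, 3, 4, 3, 4, 3, 4] j ∨
          (![1, 2, 3, 4, 3, 4, 3, 4] : Fin 8 → Fin 5) i = ![0, 0, 1, 1, 2, 2, 0, 0] j ∨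
          (![1, 2, 3, 4, 3, 4, 3, 4] : Fin 8 → Fin 5) i = ![1, 2, 3, 4, 3, 4, 3, 4] j) →
          (i, j) ∈ ([(0, 1), (0, 2), (0, 3), (1, 4), (1, 5), (2, 3), (4, 5), (2, 4), (3, 5),
            (0, 6), (1, 6), (2, 6), (4, 6), (0, 7), (1, 7), (3, 7), (5, 7), (6, 7)] :
            List (Fin 8 × Fin 8)) := by decide
      have hval : ∀ e ∈ ([(0, 1), (0, 2), (0, 3), (1, 4), (1, 5), (2, 3), (4, 5), (2, 4), (3, 5),
            (0, 6), (1, 6), (2, 6), (4, 6), (0, 7), (1, 7), (3, 7), (5, 7), (6, 7)] :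
            List (Fin 8 × Fin 8)), (![α, β, a₁, a₂, b₁, b₂, x₁, x₂] : Fin 8 → ℕ) e.1 ≠
            (![α, β, a₁, a₂, b₁, b₂, x₁, x₂] : Fin 8 → ℕ) e.2 := by
        simp only [List.forall_mem_cons, List.not_mem_nil, false_implies, implies_true, and_true]
        exact ⟨h.1.1, h.1.2.1, h.1.2.2.1, h.1.2.2.2.1, h.1.2.2.2.2.1, h.1.2.2.2.2.2.1,
          h.1.2.2.2.2.2.2.1, h.1.2.2.2.2.2.2.2.1, h.1.2.2.2.2.2.2.2.2, h.2.1.1.symm,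
          h.2.1.2.1.symm, h.2.1.2.2.1.symm, h.2.1.2.2.2.symm, h.2.2.1.1.symm, h.2.2.1.2.1.symm,
          h.2.2.1.2.2.1.symm, h.2.2.1.2.2.2.symm, h.2.2.2⟩
      intro i j hij hs
      rcases lt_or_gt_of_ne hij with hlt | hlt
      · exact hval _ (key i j hlt hs)
      · exact (hval _ (key j i hlt (by
          rcases hs with h | h | h | h
          · exact Or.inl h.symm
          · exact Or.inr (Or.inr (Or.inl h.symm))
          · exact Or.inr (Or.inl h.symm)
          · exact Or.inr (Or.inr (Or.inr h.symm))))).symm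

/-- First ends of the edges of the wheel with six spokes: `0` is joined to all of `1`, ..., `6`, and
`1 4 2 5 3 6` is a cycle. -/
def wheelFst : Fin 12 → Fin 7 := ![0, 0, 0, 1, 1, 2, 2, 3, 3, 0, 0, 0]

/-- Second ends of the edges of the wheel with six spokes. -/
def wheelSnd : Fin 12 → Fin 7 := ![1, 2, 3, 4, 6, 4, 5, 5, 6, 4, 5, 6]

/-- The pairs of edges of the wheel with six spokes with a common end. -/
def wheelPairs : List (Fin 12 × Fin 12) :=
  -- The pairs with edge `2` come first: its exponent will be `0`, so these factors cause no
  -- branching in the recursion.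
  [(2, 0), (2, 8), (2, 7), (2, 1), (2, 10), (2, 9), (2, 11), (6, 5), (6, 7), (6, 1), (6,
    10), (0, 4), (0, 1), (0, 3), (0, 10), (0, 9), (0, 11), (8, 4), (8, 7), (8, 11), (4,
    3), (4, 11), (5, 1), (5, 3), (5, 9), (7, 10), (1, 10), (1, 9), (1, 11), (3, 9), (10,
    9), (10, 11), (9, 11)]

theorem mem_wheelPairs (i j : Fin 12) (hij : i ≠ j)
    (h : wheelFst i = wheelFst j ∨ wheelFst i = wheelSnd j ∨ wheelSnd i = wheelFst j ∨
      wheelSnd i = wheelSnd j) : (i, j) ∈ wheelPairs ∨ (j, i) ∈ wheelPairs := by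
  revert i j
  decide

/-- The lists will have sizes `3` (nine edges) and `7` (three edges). Exponents `2` and `6` would
sum to `36`; since there are `33` factors, edges `2` and `10` get smaller exponents. -/
theorem diffProdCoeff_wheelPairs :
    diffProdCoeff wheelPairs ![2, 2, 0, 2, 2, 2, 2, 2, 2, 6, 5, 6] ≠ 0 := by
  decide +kernel

-- The hub has no edges outside the wheel, and neither do `4`, `5`, `6`; each of `1`, `2`, `3` costs
-- at most four colours. So edges at `1`, `2`, `3` keep three colours and the other spokes seven.
open scoped Classical in
theorem FinChoosable.of_three_triples {V : Type*} [Fintype V] {G : SimpleGraph V}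
    (p : Fin 7 → V) (hp : Function.Injective p)
    (hadj : ∀ i, G.Adj (p (wheelFst i)) (p (wheelSnd i)))
    (hdeg : ∀ j, G.degree (p j) ≤ ![6, 7, 7, 7, 3, 3, 3] j)
    (hG : ∀ G' ≤ G, G' ≠ G → G'.FinChoosable 7) : G.FinChoosable 7 := by
  refine FinChoosable.of_edges p hp wheelFst wheelSnd (hG _ (deleteEdges_le _) ?_) hadj
    ![3, 3, 3, 3, 3, 3, 3, 3, 3, 7, 7, 7] ![6, 3, 3, 3, 3, 3, 3] ?_ ?_ ?_
  · intro h
    have h1 := hadj 0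
    rw [← h, deleteEdges_adj] at h1
    exact h1.2 ⟨0, rfl⟩
  · intro x
    convert (by decide : ∀ x, (![6, 3, 3, 3, 3, 3, 3] : Fin 7 → ℕ) x ≤
      (Finset.univ.filter fun y : Fin 7 => ∃ i : Fin 12,
        (wheelFst i = x ∧ wheelSnd i = y) ∨ (wheelSnd i = x ∧ wheelFst i = y)).card) x
  · intro i
    refine le_trans (add_le_add_three le_rfl (hdeg _) (hdeg _)) ?_
    revert i
    decide
  · intro S hS
    obtain ⟨c, hc, hne⟩ := exists_colouring_of_diffProdCoeff_ne_zero wheelPairs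
      ![2, 2, 0, 2, 2, 2, 2, 2, 2, 6, 5, 6] (by decide) diffProdCoeff_wheelPairs S
      (fun i => lt_of_lt_of_le (by revert i; decide) (hS i))
    refine ⟨c, hc, fun i j hij h => ?_⟩
    rcases mem_wheelPairs i j hij h with h | h
    · exact hne _ h
    · exact (hne _ h).symm

/-! ### Tables of ranks -/

/-- The entry of a table at the row `i` and the column `w`. A table describes a stable set of
vertices, the rows, that are joined to some of at most four vertices, the columns. An entry `0` means
that the two vertices are not adjacent, and an entry `10 * (r + 1) + q` that the edge has rank `r` in
its row and `q` in its column. -/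
def entry (R : List (List ℕ)) (i w : ℕ) : ℕ := (R.getD i []).getD w 0

/-- In a table that is valid with excess `e`, all ranks are small enough for the vertices of the rows
to be reducible, when `e` is the difference of `k` and the degree of the vertex of the column `0`. -/
def IsValidTable (e : ℕ) (R : List (List ℕ)) : Prop :=
  R ≠ [] ∧ ∀ i : Fin R.length, entry R i 0 ≠ 0 ∧ ∀ w : Fin 4, entry R i w ≠ 0 →
    entry R i w / 10 - 1 + entry R i w % 10 <
      (Finset.univ.filter fun j : Fin R.length => entry R j w ≠ 0).card +
        (if w = 0 then e else 0) ∧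
    (∀ w' : Fin 4, entry R i w' ≠ 0 → entry R i w / 10 - 1 = entry R i w' / 10 - 1 → w = w') ∧
    ∀ j : Fin R.length, entry R j w ≠ 0 → entry R i w % 10 = entry R j w % 10 → i = j

instance (e : ℕ) (R : List (List ℕ)) : Decidable (IsValidTable e R) := by
  unfold IsValidTable
  infer_instance

/-- The set of columns other than the column `0` with a nonzero entry in a row, as a number. -/
def rowMask (ρ : List ℕ) : ℕ :=
  (if ρ.getD 1 0 ≠ 0 then 1 else 0) + (if ρ.getD 2 0 ≠ 0 then 2 else 0) +
    (if ρ.getD 3 0 ≠ 0 then 4 else 0)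

/-- All tables that result from permutations of the columns other than the column `0`. -/
def permuteColumns (T : List (List (List ℕ))) : List (List (List ℕ)) :=
  T.flatMap fun R => [[0, 1, 2, 3], [0, 1, 3, 2], [0, 2, 1, 3], [0, 2, 3, 1], [0, 3, 1, 2],
    [0, 3, 2, 1]].map fun π => R.map fun ρ => π.map fun w => ρ.getD w 0

/-- Valid tables with excess `0`. -/
def baseTables : List (List (List ℕ)) :=
  [[[11, 20, 0, 0], [20, 11, 0, 0]],
    [[12, 21, 0, 0], [30, 12, 20, 0], [21, 30, 11, 0]],
    [[12, 20, 0, 0], [30, 11, 20, 0], [21, 0, 11, 0]],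
    [[12, 21, 30, 0], [30, 12, 21, 0], [21, 30, 12, 0]],
    [[13, 22, 0, 0], [22, 13, 30, 0], [31, 40, 12, 20], [40, 31, 21, 11]],
    [[13, 22, 0, 0], [30, 13, 20, 0], [31, 40, 11, 20], [22, 31, 0, 11]],
    [[13, 21, 0, 0], [22, 12, 30, 0], [40, 30, 12, 20], [31, 0, 21, 11]],
    [[13, 21, 0, 0], [31, 12, 20, 0], [40, 30, 11, 20], [22, 0, 0, 11]],
    [[13, 21, 0, 0], [30, 12, 20, 0], [22, 30, 0, 11], [31, 0, 11, 20]],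
    [[13, 20, 0, 0], [22, 11, 30, 0], [30, 0, 12, 20], [31, 0, 21, 11]],
    [[13, 20, 0, 0], [30, 11, 20, 0], [31, 0, 11, 20], [22, 0, 0, 11]],
    [[13, 20, 0, 0], [40, 11, 21, 30], [31, 0, 12, 21], [22, 0, 30, 12]],
    [[13, 22, 30, 0], [22, 13, 31, 0], [31, 40, 13, 20], [40, 31, 22, 11]],
    [[13, 22, 30, 0], [30, 13, 21, 0], [31, 40, 12, 20], [22, 31, 0, 11]],
    [[13, 30, 20, 0], [22, 31, 11, 0], [30, 13, 0, 20], [31, 22, 0, 11]],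
    [[13, 21, 30, 0], [30, 12, 21, 0], [22, 30, 0, 11], [31, 0, 12, 20]],
    [[13, 22, 31, 0], [22, 13, 40, 30], [31, 40, 13, 21], [40, 31, 22, 12]],
    [[13, 22, 30, 0], [40, 13, 21, 30], [31, 40, 12, 21], [22, 31, 0, 12]],
    [[13, 21, 30, 0], [40, 12, 21, 30], [22, 30, 0, 12], [31, 0, 12, 21]],
    [[13, 22, 31, 40], [22, 13, 40, 31], [31, 40, 13, 22], [40, 31, 22, 13]],
    [[13, 21, 0, 0], [14, 22, 40, 30], [40, 13, 31, 21], [31, 40, 22, 12], [22, 0, 13, 0]],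
    [[14, 20, 0, 0], [40, 11, 21, 30], [41, 12, 30, 21], [22, 0, 12, 0], [23, 0, 0, 12]]]

/-- Further tables that are valid with excess `1`. -/
def excessTables : List (List (List ℕ)) :=
  [[[22, 12, 30, 0], [31, 21, 12, 0], [40, 30, 21, 10]],
    [[30, 12, 20, 0], [22, 30, 11, 0], [31, 21, 0, 10]]]

/-- A finite check. Excess `1` only relaxes the bound in column `0`, which is why the base tables
serve for both values. -/
theorem isValidTable_of_mem {e : ℕ} (he : e = 0 ∨ e = 1) {R : List (List ℕ)}
    (hR : R ∈ permuteColumns (baseTables ++ if e = 0 then [] else excessTables)) :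
    IsValidTable e R := by
  have h0 : ∀ R ∈ permuteColumns baseTables, IsValidTable 0 R := by decide +kernel
  have h1 : ∀ R ∈ permuteColumns (baseTables ++ excessTables), IsValidTable 1 R := by
    decide +kernel
  rcases he with rfl | rfl
  · exact h0 R (by simpa using hR)
  · exact h1 R (by simpa using hR)

open scoped Classical in
/-- The vertices that realize a valid table are reducible. -/
theorem FinChoosable.of_isValidTable {V : Type*} [Fintype V] {G : SimpleGraph V} {k e : ℕ}
    {R : List (List ℕ)} (hR : IsValidTable e R) (x : Fin R.length → V)
    (hx : Function.Injective x) (hst : ∀ i j, ¬ G.Adj (x i) (x j)) (W : Finset V) (v : V)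
    (f : V → Fin 4) (hf : Set.InjOn f W) (hvW : v ∈ W) (hfv : f v = 0)
    (hW : ∀ i w, G.Adj (x i) w → w ∈ W)
    (hadj : ∀ i, ∀ w ∈ W, G.Adj (x i) w ↔ entry R i (f w) ≠ 0)
    (hk : ∀ w, G.degree w ≤ k) (hv : G.degree v + e ≤ k)
    (hG : ∀ G' ≤ G, G' ≠ G → G'.FinChoosable k) : G.FinChoosable k := by
  have hW' : ∀ i w, G.Adj (x i) w → entry R i (f w) ≠ 0 := fun i w h => (hadj i w (hW i w h)).1 h
  refine FinChoosable.of_stable x hx hst (hG _ (deleteEdges_le _) ?_)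
    (fun i w => entry R i (f w) / 10 - 1) (fun i w => entry R i (f w) % 10) ?_ ?_ ?_
  · intro h
    have i : Fin R.length := ⟨0, List.length_pos_iff.2 hR.1⟩
    have h1 := (hadj i v hvW).2 (by rw [hfv]; exact (hR.2 i).1)
    rw [← h, deleteEdges_adj] at h1
    exact h1.2 ⟨i, Sym2.mem_mk_left _ _⟩
  · intro i w w' h h' heq
    exact hf (hW i w h) (hW i w' h') (((hR.2 i).2 _ (hW' i w h)).2.1 _ (hW' i w' h') heq)
  · intro i j w h h' heq
    exact ((hR.2 i).2 _ (hW' i w h)).2.2 _ (hW' j w h') heq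
  · intro i w h
    have h1 := ((hR.2 i).2 _ (hW' i w h)).1
    have h2 : (Finset.univ.filter fun j => G.Adj (x j) w) =
        Finset.univ.filter fun j : Fin R.length => entry R j (f w) ≠ 0 := by
      ext j
      simp [hadj j w (hW i w h)]
    rw [h2]
    by_cases hw : f w = 0
    · obtain rfl : w = v := hf (hW i w h) hvW (hw.trans hfv.symm)
      rw [if_pos hw] at h1
      omega
    · rw [if_neg hw] at h1
      have := hk w
      omega

/-! ### Exhaustive search over the types of fan vertices -/

/-- Exhaustive search for a sublist with the property `P` in all sorted lists with `n` members
from `ms`, where `acc` is the list of members chosen already. -/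
def searchAll (P : List ℕ → Bool) (ms : List ℕ) : ℕ → ℕ → List ℕ → Bool
  | 0, _, acc => P acc
  | n + 1, lo, acc => P acc || ms.all fun m => decide (m < lo) || searchAll P ms n m (m :: acc)

/-- A sorted list follows one branch of the search, and a success at any prefix yields a part of the
list. Only sorted lists are searched because the order of the rows is irrelevant. -/
theorem exists_subperm_of_searchAll_aux (P : List ℕ → Bool) (ms : List ℕ) (l : List ℕ) (lo : ℕ)
    (acc : List ℕ) (h : searchAll P ms l.length lo acc = true) (hl : ∀ m ∈ l, m ∈ ms ∧ lo ≤ m)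
    (hs : l.Pairwise (· ≤ ·)) : ∃ l', P l' = true ∧ l'.Subperm (l ++ acc) := by
  induction l generalizing lo acc with
  | nil => exact ⟨acc, h, List.Subperm.refl _⟩
  | cons m l ih =>
    rw [List.length_cons, searchAll, Bool.or_eq_true] at h
    rcases h with h | h
    · exact ⟨acc, h, (List.sublist_append_right _ _).subperm⟩
    · rw [List.all_eq_true] at h
      obtain ⟨hm, hlo⟩ := hl m (by simp)
      have h1 := h m hm
      simp only [Bool.or_eq_true, decide_eq_true_eq, not_lt.2 hlo, false_or] at h1
      rw [List.pairwise_cons] at hs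
      obtain ⟨l', hP, hl'⟩ := ih m (m :: acc) h1
        (fun m' hm' => ⟨(hl m' (by simp [hm'])).1, hs.1 m' hm'⟩) hs.2
      exact ⟨l', hP, hl'.trans List.perm_middle.subperm⟩

theorem exists_subperm_of_searchAll {P : List ℕ → Bool} {ms l : List ℕ}
    (h : searchAll P ms l.length 0 [] = true) (hl : ∀ m ∈ l, m ∈ ms) :
    ∃ l', P l' = true ∧ l'.Subperm l := by
  have hp : (l.mergeSort (· ≤ ·)).Perm l := List.mergeSort_perm _ _
  obtain ⟨l', hP, hl'⟩ := exists_subperm_of_searchAll_aux P ms (l.mergeSort (· ≤ ·)) 0 []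
    (by rwa [hp.length_eq]) (fun m hm => ⟨hl m (hp.mem_iff.1 hm), Nat.zero_le _⟩)
    (List.pairwise_mergeSort' _ _)
  exact ⟨l', hP, (by simpa using hl' : l'.Subperm (l.mergeSort (· ≤ ·))).trans hp.subperm⟩

/-- A list of masks contains the masks of the rows of one of the tables. -/
def containsTable (T : List (List ℕ)) (l : List ℕ) : Bool :=
  T.any fun R => R.all fun m => decide (R.count m ≤ l.count m)

theorem exists_of_containsTable {T : List (List (List ℕ))} {l : List ℕ}
    (h : containsTable (T.map fun R => R.map rowMask) l = true) :
    ∃ R ∈ T, (R.map rowMask).Subperm l := by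
  simp only [containsTable, List.any_eq_true, List.all_eq_true, decide_eq_true_eq, List.mem_map,
    exists_exists_and_eq_and] at h
  obtain ⟨R, hR, h⟩ := h
  exact ⟨R, hR, List.subperm_ext_iff.2 fun m hm => h m (by simpa using hm)⟩

theorem exists_eq_map_of_subperm_map {α β : Type*} (f : α → β) {l : List β} {xs : List α}
    (h : l.Subperm (xs.map f)) : ∃ ys : List α, ys.Subperm xs ∧ l = ys.map f := by
  obtain ⟨l', hl', hs⟩ := h
  obtain ⟨zs, hzs, rfl⟩ := List.sublist_map_iff.1 hs
  have : Relation.Comp (· = List.map f ·) List.Perm l zs := by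
    rw [List.eq_map_comp_perm]
    exact hl'.symm
  obtain ⟨ys, hys, hp⟩ := this
  exact ⟨ys, ⟨zs, hp.symm, hzs⟩, hys⟩

/-- The masks of the rows of the tables with excess `e`. -/
def tableMasks (e : ℕ) : List (List ℕ) :=
  (permuteColumns (baseTables ++ if e = 0 then [] else excessTables)).map fun R => R.map rowMask

/-- In all searches the length is a lower bound for the number of fan vertices and the masks are
those that their degrees permit; `v` itself contributes no bit. Here: width `3`, `deg v = k ≥ 7`, so
at least `7 - 3` vertices of degree `2` or `3`. -/
theorem searchAll_triples_pairs : searchAll (containsTable (tableMasks 0)) [1, 2, 3, 4, 5, 6] 4 0 []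
    = true := by decide +kernel

/-- Path-width `3` with `deg v = k = 6`: at least `6 - 3` vertices, and only two columns besides
that of `v`. -/
theorem searchAll_two_columns : searchAll (containsTable (tableMasks 0)) [1, 2, 3] 3 0 []
    = true := by decide +kernel

/-- Path-width `4` with `deg v = k ≥ 10`: at least `10 - 4` vertices of degree at least `2`. -/
theorem searchAll_all : searchAll (containsTable (tableMasks 0)) [1, 2, 3, 4, 5, 6, 7] 6 0 []
    = true := by decide +kernel

/-- Path-width `4` with `deg v = k - 1`: at least `9 - 4` vertices of degree at least `3`. -/
theorem searchAll_excess : searchAll (containsTable (tableMasks 1)) [3, 5, 6, 7] 5 0 []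
    = true := by decide +kernel

/-- Path-width `4` with `deg v = k - 2`: at least `8 - 4` vertices, all of degree `4`. -/
theorem searchAll_full : searchAll (containsTable (tableMasks 0)) [7] 4 0 []
    = true := by decide +kernel

theorem searchAll_excess_four : searchAll (containsTable (tableMasks 1)) [3, 5, 6] 4 0 []
    = true := by decide +kernel

/-- Tree-width `3` with `deg v = k - 1` and only three fan vertices, of degree `3`. The tables miss
the case of three distinct neighbourhoods, which leads to the wheel with six spokes. -/
theorem searchAll_excess_three : searchAll
    (fun l => containsTable (tableMasks 1) l || decide (l = [6, 5, 3])) [3, 5, 6] 3 0 []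
    = true := by decide +kernel

theorem searchAll_two_columns_full : searchAll (containsTable (tableMasks 0)) [3] 3 0 []
    = true := by decide +kernel

/-! ### Bag sequences and the choice of `v` -/

/-- A sequence of bags `c 0, ..., c (m - 1)` from a rooted tree decomposition, in which each bag
comes before its parent. -/
structure IsBagSequence {V : Type*} (G : SimpleGraph V) (m : ℕ) (c : ℕ → Finset V) : Prop where
  exists_mem : ∀ v, ∃ j < m, v ∈ c j
  exists_adj : ∀ v w, G.Adj v w → ∃ j < m, v ∈ c j ∧ w ∈ c j
  parent : ∀ j < m, ∃ p > j, ∀ y ∈ c j, ∀ l < m, j < l → y ∈ c l → p < m ∧ y ∈ c p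

theorem IsBagSequence.mono {V : Type*} {G G' : SimpleGraph V} {m : ℕ} {c : ℕ → Finset V}
    (h : G.IsBagSequence m c) (hle : G' ≤ G) : G'.IsBagSequence m c :=
  ⟨h.exists_mem, fun v w hvw => h.exists_adj v w (hle hvw), h.parent⟩

/-- Strip off a leaf and put its bag first; its parent is its only neighbour, which every path
leaving the leaf must use. -/
theorem exists_bag_sequence_of_isTree {V : Type*} (n : ℕ) {N : Type} [Fintype N]
    (hn : Fintype.card N = n) (T : SimpleGraph N) (hT : T.IsTree) (bag : N → Finset V)
    (hpath : ∀ (v : V) (t₁ t₂ : N), v ∈ bag t₁ → v ∈ bag t₂ →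
      ∀ p : T.Walk t₁ t₂, p.IsPath → ∀ t ∈ p.support, v ∈ bag t) :
    ∃ (m : ℕ) (c : ℕ → Finset V), (∀ t, ∃ j < m, c j = bag t) ∧ (∀ j < m, ∃ t, c j = bag t) ∧
      ∀ j < m, ∃ p > j, ∀ y ∈ c j, ∀ l < m, j < l → y ∈ c l → p < m ∧ y ∈ c p := by
  classical
  induction n generalizing N with
  | zero =>
    have := hT.connected.nonempty
    exact absurd hn Fintype.card_ne_zero
  | succ n ih =>
    rcases subsingleton_or_nontrivial N with hs | hnt
    · obtain ⟨t₀⟩ := hT.connected.nonempty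
      refine ⟨1, fun _ => bag t₀, fun t => ⟨0, one_pos, by rw [Subsingleton.elim t₀ t]⟩,
        fun j _ => ⟨t₀, rfl⟩, fun j hj => ⟨j + 1, j.lt_succ_self, fun y _ l hl hjl => ?_⟩⟩
      omega
    · obtain ⟨ℓ, hℓ⟩ := hT.exists_vert_degree_one_of_nontrivial
      obtain ⟨u, hu, huniq⟩ := degree_eq_one_iff_existsUnique_adj.1 hℓ
      have hT' : (T.induce {ℓ}ᶜ).IsTree :=
        ⟨hT.connected.induce_compl_singleton_of_degree_eq_one hℓ, hT.isAcyclic.induce _⟩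
      obtain ⟨m, c, h1, h2, h3⟩ := ih (N := ({ℓ}ᶜ : Set N)) (by
          rw [Fintype.card_compl_set, hn]; simp) (T.induce {ℓ}ᶜ) hT' (fun t => bag t) (by
          intro v t₁ t₂ ht₁ ht₂ p hp t ht
          refine hpath v t₁ t₂ ht₁ ht₂ (p.map (Embedding.induce {ℓ}ᶜ).toHom)
            (hp.map (Embedding.induce (G := T) {ℓ}ᶜ).injective) t ?_
          exact (Walk.support_map (Embedding.induce (G := T) {ℓ}ᶜ).toHom p).symm ▸
            List.mem_map.2 ⟨t, ht, rfl⟩)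
      refine ⟨m + 1, fun j => Nat.casesOn j (bag ℓ) c, ?_, ?_, ?_⟩
      · intro t
        by_cases ht : t = ℓ
        · exact ⟨0, m.succ_pos, ht ▸ rfl⟩
        · obtain ⟨j, hj, he⟩ := h1 ⟨t, ht⟩
          exact ⟨j + 1, by omega, he⟩
      · intro j hj
        cases j with
        | zero => exact ⟨ℓ, rfl⟩
        | succ j =>
          obtain ⟨t, ht⟩ := h2 j (by omega)
          exact ⟨t, ht⟩
      · intro j hj
        cases j with
        | zero =>
          obtain ⟨p, hp, hpe⟩ := h1 ⟨u, hu.ne'⟩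
          refine ⟨p + 1, p.succ_pos, fun y hy l hl h0l hyl => ⟨by omega, ?_⟩⟩
          cases l with
          | zero => omega
          | succ l =>
            obtain ⟨t, ht⟩ := h2 l (by omega)
            have hyt : y ∈ bag t := by rw [← ht]; exact hyl
            obtain ⟨q, hq⟩ := hT.connected.exists_isPath ℓ t
            have hnil : ¬ q.Nil := Walk.not_nil_of_ne (Ne.symm t.2)
            have := hpath y ℓ t hy hyt q hq q.snd (q.getVert_mem_support 1)
            rw [huniq _ (q.adj_snd hnil)] at this
            change y ∈ c p
            rw [hpe]
            exact this
        | succ j =>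
          obtain ⟨p, hp, hpp⟩ := h3 j (by omega)
          refine ⟨p + 1, by omega, fun y hy l hl hjl hyl => ?_⟩
          cases l with
          | zero => omega
          | succ l =>
            have := hpp y hy l (by omega) (by omega) hyl
            exact ⟨by omega, this.2⟩

theorem TreeDecomposition.exists_isBagSequence {V : Type*} {G : SimpleGraph V}
    (D : G.TreeDecomposition) : ∃ (m : ℕ) (c : ℕ → Finset V), G.IsBagSequence m c ∧
      ∀ j < m, ∃ t, c j = D.bag t := by
  have := D.finite_node
  have := Fintype.ofFinite D.node
  obtain ⟨m, c, h1, h2, h3⟩ := exists_bag_sequence_of_isTree _ rfl D.tree D.isTree D.bag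
    D.mem_bag_of_mem_path
  refine ⟨m, c, ⟨fun v => ?_, fun v w h => ?_, h3⟩, h2⟩
  · obtain ⟨t, ht⟩ := D.exists_mem_bag v
    obtain ⟨j, hj, he⟩ := h1 t
    exact ⟨j, hj, he ▸ ht⟩
  · obtain ⟨t, ht⟩ := D.exists_adj_mem_bag v w h
    obtain ⟨j, hj, he⟩ := h1 t
    exact ⟨j, hj, he ▸ ht⟩

theorem mem_support_of_walk_pathGraph {n : ℕ} {a b : Fin n} (p : (pathGraph n).Walk a b)
    {i : Fin n} (ha : a ≤ i) (hb : i ≤ b) : i ∈ p.support := by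
  induction p with
  | nil => simp [le_antisymm hb ha]
  | @cons a a' b h p ih =>
    rw [Walk.support_cons, List.mem_cons]
    by_cases hi : i = a
    · exact Or.inl hi
    · refine Or.inr (ih ?_ hb)
      rw [pathGraph_adj] at h
      rw [Fin.le_def] at *
      have := Fin.val_ne_of_ne hi
      omega

theorem TreeDecomposition.exists_isBagSequence_of_path {V : Type*} {G : SimpleGraph V}
    (D : G.TreeDecomposition) (hD : D.IsPathDecomposition) :
    ∃ (m : ℕ) (c : ℕ → Finset V), G.IsBagSequence m c ∧ (∀ j < m, ∃ t, c j = D.bag t) ∧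
      ∀ y i j l, i ≤ j → j ≤ l → l < m → y ∈ c i → y ∈ c l → y ∈ c j := by
  obtain ⟨n, ⟨e⟩⟩ := hD
  set c : ℕ → Finset V := fun j => if h : j < n then D.bag (e.symm ⟨j, h⟩) else ∅ with hc
  have hcj : ∀ j (h : j < n), c j = D.bag (e.symm ⟨j, h⟩) := fun j h => by simp [hc, h]
  have hce : ∀ t, ∃ j < n, c j = D.bag t := fun t => ⟨e t, (e t).2, by rw [hcj _ (e t).2]; simp⟩
  have hconv : ∀ y i j l, i ≤ j → j ≤ l → l < n → y ∈ c i → y ∈ c l → y ∈ c j := by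
    intro y i j l hij hjl hl hi hl'
    rw [hcj _ (by omega)] at hi hl' ⊢
    obtain ⟨q, hq⟩ := D.isTree.connected.exists_isPath (e.symm ⟨i, by omega⟩) (e.symm ⟨l, hl⟩)
    refine D.mem_bag_of_mem_path y _ _ hi hl' q hq _ ?_
    have hmem := mem_support_of_walk_pathGraph (q.map e.toHom) (i := ⟨j, by omega⟩)
      (by simpa [Fin.le_def] using hij) (by simpa [Fin.le_def] using hjl)
    rw [Walk.support_map, List.mem_map] at hmem
    obtain ⟨t, ht, he⟩ := hmem
    rw [← he]
    simpa using ht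
  refine ⟨n, c, ⟨fun v => ?_, fun v w h => ?_, fun j hj => ?_⟩, fun j hj => ⟨_, hcj j hj⟩, hconv⟩
  · obtain ⟨t, ht⟩ := D.exists_mem_bag v
    obtain ⟨j, hj, he⟩ := hce t
    exact ⟨j, hj, he ▸ ht⟩
  · obtain ⟨t, ht⟩ := D.exists_adj_mem_bag v w h
    obtain ⟨j, hj, he⟩ := hce t
    exact ⟨j, hj, he ▸ ht⟩
  · exact ⟨j + 1, j.lt_succ_self, fun y hy l hl hjl hyl =>
      ⟨by omega, hconv y j (j + 1) l (by omega) hjl hl hy hyl⟩⟩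

/-- A set that fits into one bag moves up from parent to parent, since each of its members reappears
at `i` or later. As `v` moves along, the walk cannot skip the last bag `i` of `v`. -/
theorem IsBagSequence.subset_bag {V : Type*} {G : SimpleGraph V} {m : ℕ} {c : ℕ → Finset V}
    (h : G.IsBagSequence m c) {v : V} {i : ℕ} (hi : i < m) (hvi : v ∈ c i)
    (hlast : ∀ l, i < l → l < m → v ∉ c l) {A : Set V} (hvA : v ∈ A)
    (hA : ∀ y ∈ A, ∃ l, i ≤ l ∧ l < m ∧ y ∈ c l) (j : ℕ) (hj : j ≤ i) (hAj : ∀ y ∈ A, y ∈ c j) :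
    ∀ y ∈ A, y ∈ c i := by
  induction hn : i - j using Nat.strong_induction_on generalizing j with
  | _ n ih =>
  rcases hj.eq_or_lt with rfl | hlt
  · exact hAj
  · obtain ⟨p, hp, hpar⟩ := h.parent j (by omega)
    have hvp := hpar v (hAj v hvA) i hi hlt hvi
    have hpi : p ≤ i := by
      by_contra hlt'
      exact hlast p (by omega) hvp.1 hvp.2
    refine ih (i - p) (by omega) p hpi (fun y hy => ?_) rfl
    obtain ⟨l, hil, hl, hyl⟩ := hA y hy
    exact (hpar y (hAj y hy) l hl (by omega) hyl).2

/-- In a graph with a bag sequence whose small vertices are stable, there is a big vertex `v` such that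
the small neighbours of `v` outside of some bag have all their neighbours in this bag. -/
theorem IsBagSequence.exists_vertex {V : Type*} [Finite V] {G : SimpleGraph V} {m : ℕ} {c : ℕ → Finset V}
    (h : G.IsBagSequence m c) {ω : ℕ} (hω : ∀ j < m, (c j).card ≤ ω + 1) (big : V → Prop)
    (hbig : ∃ v, big v) (hst : ∀ x y, G.Adj x y → big x ∨ big y) :
    ∃ (v : V) (W : Finset V), big v ∧ v ∈ W ∧ W.card ≤ ω + 1 ∧
      (∀ x, G.Adj v x → x ∉ W → ¬ big x ∧ (∀ y, G.Adj x y → y ∈ W) ∧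
        ∃ B : Finset V, B.card ≤ ω ∧ ∀ y, G.Adj x y → y ∈ B) ∧
      ((∀ y i j l, i ≤ j → j ≤ l → l < m → y ∈ c i → y ∈ c l → y ∈ c j) →
        ∃ W' : Finset V, W'.card ≤ ω ∧ ∀ x, G.Adj v x → x ∉ W → ∀ y, G.Adj x y → y ∈ W') := by
  classical
  have hex : ∀ x, ∃ j, j < m ∧ x ∈ c j ∧ ∀ l, j < l → l < m → x ∉ c l := by
    intro x
    obtain ⟨j₀, hj₀, hx₀⟩ := h.exists_mem x
    obtain ⟨j, hj, hmax⟩ := Finset.exists_max_image ((Finset.range m).filter fun j => x ∈ c j) id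
      ⟨j₀, by simp [hj₀, hx₀]⟩
    simp only [Finset.mem_filter, Finset.mem_range, id] at hj hmax
    exact ⟨j, hj.1, hj.2, fun l hl hlm hxl => absurd (hmax l ⟨hlm, hxl⟩) (not_le.2 hl)⟩
  choose last hlm hlmem hlast using hex
  -- The big vertex that disappears first. Any vertex whose last bag is earlier must be small.
  obtain ⟨v, hv, hmin⟩ : ∃ v, big v ∧ ∀ y, big y → last v ≤ last y := by
    have hP : ∃ n v, big v ∧ last v = n := by
      obtain ⟨v, hv⟩ := hbig
      exact ⟨_, v, hv, rfl⟩
    obtain ⟨v, hv, he⟩ := Nat.find_spec hP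
    exact ⟨v, hv, fun y hy => he ▸ Nat.find_min' hP ⟨y, hy, rfl⟩⟩
  have hle : ∀ x j, j < m → x ∈ c j → j ≤ last x := by
    intro x j hj hx
    by_contra hlt
    exact hlast x j (not_le.1 hlt) hj hx
  have happ : ∀ y, last v ≤ last y → ∃ l, last v ≤ l ∧ l < m ∧ y ∈ c l := fun y hy =>
    ⟨last y, hy, hlm y, hlmem y⟩
  have hlt : ∀ x, G.Adj v x → x ∉ c (last v) → last x < last v := by
    intro x hvx hx
    by_contra! hge
    obtain ⟨j, hj, hvj, hxj⟩ := h.exists_adj v x hvx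
    refine hx (h.subset_bag (hlm v) (hlmem v) (hlast v) (A := {v, x}) (by simp) ?_ j
      (hle v j hj hvj) ?_ x (by simp))
    · rintro y (rfl | rfl)
      · exact happ _ le_rfl
      · exact happ _ hge
    · rintro y (rfl | rfl) <;> assumption
  have hsmall : ∀ x, G.Adj v x → x ∉ c (last v) → ¬ big x := fun x hvx hx hb =>
    absurd (hmin x hb) (not_le.2 (hlt x hvx hx))
  have hnb : ∀ x, ¬ big x → ∀ y, G.Adj x y → big y := fun x hx y hxy => (hst x y hxy).resolve_left hx
  have hbag : ∀ x, G.Adj v x → x ∉ c (last v) → ∀ y, G.Adj x y → y ∈ c (last x) := by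
    intro x hvx hx y hxy
    have hly := hmin y (hnb x (hsmall x hvx hx) y hxy)
    have hlx := hlt x hvx hx
    obtain ⟨j, hj, hxj, hyj⟩ := h.exists_adj x y hxy
    refine h.subset_bag (hlm x) (hlmem x) (hlast x) (A := {x, y}) (by simp) ?_ j
      (hle x j hj hxj) ?_ y (by simp)
    · rintro z (rfl | rfl)
      · exact ⟨_, le_rfl, hlm _, hlmem _⟩
      · exact ⟨last z, by omega, hlm _, hlmem _⟩
    · rintro z (rfl | rfl) <;> assumption
  have hcard : ∀ x, ((c (last x)).erase x).card ≤ ω := by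
    intro x
    have h1 := Finset.card_erase_add_one (hlmem x)
    have h2 := hω _ (hlm x)
    omega
  -- The neighbours of `x` are big, so they survive until the last bag of `v`; they already share
  -- the last bag of `x` and move up together with `v`.
  have hW : ∀ x, G.Adj v x → x ∉ c (last v) → ∀ y, G.Adj x y → y ∈ c (last v) := by
    intro x hvx hx
    exact h.subset_bag (hlm v) (hlmem v) (hlast v) (A := {y | G.Adj x y}) hvx.symm
      (fun y hy => happ y (hmin y (hnb x (hsmall x hvx hx) y hy))) (last x) (hlt x hvx hx).le
      (hbag x hvx hx)
  refine ⟨v, c (last v), hv, hlmem v, hω _ (hlm v), fun x hvx hx => ⟨hsmall x hvx hx, hW x hvx hx,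
    (c (last x)).erase x, hcard x, fun y hxy =>
      Finset.mem_erase.2 ⟨hxy.ne', hbag x hvx hx y hxy⟩⟩, fun hconv => ?_⟩
  by_cases hS : ∃ x, G.Adj v x ∧ x ∉ c (last v)
  -- On a path, the last bag of the latest fan vertex `x₀` separates all earlier last bags from `W`,
  -- so it contains every neighbour of a fan vertex. Removing `x₀`, which is small and hence no such
  -- neighbour, saves one.
  · obtain ⟨x₀, ⟨hx₀, hx₀W⟩, hmax⟩ : ∃ x₀, (G.Adj v x₀ ∧ x₀ ∉ c (last v)) ∧
        ∀ x, G.Adj v x → x ∉ c (last v) → last x ≤ last x₀ := by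
      obtain ⟨x₁, hx₁⟩ := hS
      obtain ⟨x, hx, hn⟩ := Set.exists_max_image {x | G.Adj v x ∧ x ∉ c (last v)} last
        (Set.toFinite _) ⟨x₁, hx₁⟩
      exact ⟨x, hx, fun x' h1 h2 => hn x' ⟨h1, h2⟩⟩
    refine ⟨(c (last x₀)).erase x₀, hcard x₀, fun x hvx hx y hxy => Finset.mem_erase.2 ⟨?_, ?_⟩⟩
    · rintro rfl
      exact hsmall y hx₀ hx₀W (hnb x (hsmall x hvx hx) y hxy)
    · exact hconv y (last x) (last x₀) (last v) (hmax x hvx hx) (hlt x₀ hx₀ hx₀W).le (hlm v)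
        (hbag x hvx hx y hxy) (hW x hvx hx y hxy)
  · exact ⟨∅, by simp, fun x hvx hx => absurd ⟨x, hvx, hx⟩ hS⟩

/-! ### Labels and masks -/

open scoped Classical in
/-- The set of labels in `{1, 2, 3}` of the neighbours of `x` in `W`, as a number. -/
noncomputable def vertexMask {V : Type*} (G : SimpleGraph V) (W : Finset V) (f : V → Fin 4)
    (x : V) : ℕ :=
  (if ∃ w ∈ W, f w = 1 ∧ G.Adj x w then 1 else 0) +
    (if ∃ w ∈ W, f w = 2 ∧ G.Adj x w then 2 else 0) +
    (if ∃ w ∈ W, f w = 3 ∧ G.Adj x w then 4 else 0)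

/-- Labels index table columns, with `0` reserved for `v`. The last clause excludes label `3` when
`W` has at most three elements. -/
theorem exists_labelling {V : Type*} (W : Finset V) {v : V} (hv : v ∈ W) (hW : W.card ≤ 4) :
    ∃ f : V → Fin 4, Set.InjOn f W ∧ f v = 0 ∧ ∀ w ∈ W, (f w : ℕ) < W.card := by
  classical
  have hc := Finset.card_erase_add_one hv
  let g := (W.erase v).equivFin
  have hg : ∀ w, (g w : ℕ) < (W.erase v).card := fun w => (g w).2
  refine ⟨fun w => if h : w ∈ W.erase v then ⟨g ⟨w, h⟩ + 1, by have := hg ⟨w, h⟩; omega⟩ else 0,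
    ?_, by simp, ?_⟩
  · intro w hw w' hw' h
    by_cases h1 : w ∈ W.erase v <;> by_cases h2 : w' ∈ W.erase v
    · simp only [h1, h2, dif_pos, Fin.mk.injEq, Nat.add_right_cancel_iff] at h
      have := g.injective (Fin.ext h)
      exact congrArg Subtype.val this
    · simp only [h1, h2, dif_pos, dif_neg, not_false_eq_true] at h
      have := congrArg Fin.val h
      simp at this
    · simp only [h1, h2, dif_pos, dif_neg, not_false_eq_true] at h
      have := congrArg Fin.val h
      simp at this
    · simp only [Finset.mem_erase, not_and_or, not_not] at h1 h2
      rw [h1.resolve_right (not_not.2 hw), h2.resolve_right (not_not.2 hw')]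
  · intro w hw
    by_cases h1 : w ∈ W.erase v
    · have := hg ⟨w, h1⟩
      simp only [h1, dif_pos]
      omega
    · simp only [h1, dif_neg, not_false_eq_true]
      exact Finset.card_pos.2 ⟨v, hv⟩

section

variable {V : Type*} {G : SimpleGraph V} {W : Finset V} {f : V → Fin 4} {v : V}

open scoped Classical in
theorem degree_eq_of_labelling [Fintype V] (hf : Set.InjOn f W) (hv : v ∈ W) (hfv : f v = 0)
    {x : V} (hxv : G.Adj v x) (hx : ∀ w, G.Adj x w → w ∈ W) :
    G.degree x = 1 + (if ∃ w ∈ W, f w = 1 ∧ G.Adj x w then 1 else 0) +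
      (if ∃ w ∈ W, f w = 2 ∧ G.Adj x w then 1 else 0) +
      (if ∃ w ∈ W, f w = 3 ∧ G.Adj x w then 1 else 0) := by
  have h0 : ∃ w ∈ W, f w = 0 ∧ G.Adj x w := ⟨v, hv, hfv, hxv.symm⟩
  have himg : (G.neighborFinset x).image f =
      Finset.univ.filter fun j => ∃ w ∈ W, f w = j ∧ G.Adj x w := by
    ext j
    simp only [Finset.mem_image, mem_neighborFinset, Finset.mem_filter, Finset.mem_univ, true_and]
    exact ⟨fun ⟨w, hw, h⟩ => ⟨w, hx w hw, h, hw⟩, fun ⟨w, _, h, hw⟩ => ⟨w, hw, h⟩⟩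
  rw [← card_neighborFinset_eq_degree, ← Finset.card_image_of_injOn (f := f), himg,
    Finset.card_filter, Fin.sum_univ_four, if_pos h0]
  intro w hw w' hw' h
  simp only [Finset.mem_coe, mem_neighborFinset] at hw hw'
  exact hf (hx w hw) (hx w' hw') h

theorem iff_of_binary_eq {p₁ p₂ p₃ q₁ q₂ q₃ : Prop} [Decidable p₁] [Decidable p₂] [Decidable p₃]
    [Decidable q₁] [Decidable q₂] [Decidable q₃]
    (h : (if p₁ then 1 else 0) + (if p₂ then 2 else 0) + (if p₃ then 4 else 0) =
      (if q₁ then 1 else 0) + (if q₂ then 2 else 0) + (if q₃ then 4 else 0)) :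
    (p₁ ↔ q₁) ∧ (p₂ ↔ q₂) ∧ (p₃ ↔ q₃) := by
  by_cases p₁ <;> by_cases p₂ <;> by_cases p₃ <;> by_cases q₁ <;> by_cases q₂ <;> by_cases q₃ <;>
    simp_all

/-- The binary digits of the mask determine adjacency at labels `1`, `2`, `3`; label `0` belongs to
`v`, which is adjacent to `x` anyway. -/
theorem adj_iff_of_rowMask_eq (hf : Set.InjOn f W) (hv : v ∈ W) (hfv : f v = 0) {x : V}
    (hxv : G.Adj v x) {ρ : List ℕ} (hρ : ρ.getD 0 0 ≠ 0) (h : rowMask ρ = vertexMask G W f x)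
    {w : V} (hw : w ∈ W) : G.Adj x w ↔ ρ.getD (f w) 0 ≠ 0 := by
  have key : ∀ j : Fin 4, (∃ w ∈ W, f w = j ∧ G.Adj x w) ↔ ρ.getD j 0 ≠ 0 := by
    intro j
    classical
    have hb := iff_of_binary_eq h
    fin_cases j
    · exact iff_of_true ⟨v, hv, hfv, hxv.symm⟩ hρ
    · exact hb.1.symm
    · exact hb.2.1.symm
    · exact hb.2.2.symm
  rw [← key]
  refine ⟨fun h => ⟨w, hw, rfl, h⟩, ?_⟩
  rintro ⟨w', hw', he, ha⟩
  rwa [hf hw hw' he.symm]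

open scoped Classical in
theorem FinChoosable.of_rowMask_subperm [Fintype V] {k e : ℕ} {R : List (List ℕ)}
    (hR : IsValidTable e R) (hf : Set.InjOn f W) (hv : v ∈ W) (hfv : f v = 0)
    {xs : List V} (hxs : xs.Nodup) (hxv : ∀ x ∈ xs, G.Adj v x)
    (hxW : ∀ x ∈ xs, ∀ w, G.Adj x w → w ∈ W) (hst : ∀ x ∈ xs, ∀ y ∈ xs, ¬ G.Adj x y)
    (hsub : (R.map rowMask).Subperm (xs.map (vertexMask G W f)))
    (hk : ∀ w, G.degree w ≤ k) (hve : G.degree v + e ≤ k)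
    (hG : ∀ G' ≤ G, G' ≠ G → G'.FinChoosable k) : G.FinChoosable k := by
  obtain ⟨ys, hys, he⟩ := exists_eq_map_of_subperm_map _ hsub
  have hnd : ys.Nodup := by
    obtain ⟨l, hl, hs⟩ := hys
    exact hl.nodup_iff.1 (hxs.sublist hs)
  have hlen : ys.length = R.length := by simpa using (congrArg List.length he).symm
  have hmem : ∀ i : Fin R.length, ys[i]'(by omega) ∈ xs := fun i =>
    hys.subset (List.getElem_mem _)
  refine FinChoosable.of_isValidTable hR (fun i => ys[i]'(by omega)) ?_
    (fun i j => hst _ (hmem i) _ (hmem j)) W v f hf hv hfv (fun i => hxW _ (hmem i)) ?_ hk hve hG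
  · intro i j hij
    exact Fin.ext ((hnd.getElem_inj_iff).1 hij)
  · intro i w hw
    have hent : ∀ j, entry R i j = (R[i]).getD j 0 := by
      intro j
      simp [entry]
    have h1 : rowMask R[i] = vertexMask G W f (ys[i]'(by omega)) := by
      have : (R.map rowMask)[(i : ℕ)]'(by simp) =
        (ys.map (vertexMask G W f))[(i : ℕ)]'(by simp; omega) := by simp only [he]
      simpa using this
    rw [hent]
    exact adj_iff_of_rowMask_eq hf hv hfv (hxv _ (hmem i)) (by rw [← hent]; exact (hR.2 i).1) h1 hw

open scoped Classical in
theorem FinChoosable.of_searchAll [Fintype V] {k e n : ℕ} {ms : List ℕ}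
    (he : e = 0 ∨ e = 1) (hsearch : searchAll (containsTable (tableMasks e)) ms n 0 [] = true)
    (hf : Set.InjOn f W) (hv : v ∈ W) (hfv : f v = 0) {S : Finset V} (hS : n ≤ S.card)
    (hxv : ∀ x ∈ S, G.Adj v x) (hxW : ∀ x ∈ S, ∀ w, G.Adj x w → w ∈ W)
    (hst : ∀ x ∈ S, ∀ y ∈ S, ¬ G.Adj x y) (hms : ∀ x ∈ S, vertexMask G W f x ∈ ms)
    (hk : ∀ w, G.degree w ≤ k) (hve : G.degree v + e ≤ k)
    (hG : ∀ G' ≤ G, G' ≠ G → G'.FinChoosable k) : G.FinChoosable k := by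
  obtain ⟨T, hTS, rfl⟩ := Finset.exists_subset_card_eq hS
  have hmem : ∀ x ∈ T.toList, x ∈ S := fun x hx => hTS (Finset.mem_toList.1 hx)
  obtain ⟨l, hl, hsub⟩ := exists_subperm_of_searchAll (l := T.toList.map (vertexMask G W f))
    (by simpa using hsearch) (by
      intro m hm
      obtain ⟨x, hx, rfl⟩ := List.mem_map.1 hm
      exact hms x (hmem x hx))
  obtain ⟨R, hR, hRl⟩ := exists_of_containsTable hl
  exact FinChoosable.of_rowMask_subperm (isValidTable_of_mem he hR) hf hv hfv T.nodup_toList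
    (fun x hx => hxv x (hmem x hx)) (fun x hx => hxW x (hmem x hx))
    (fun x hx y hy => hst x (hmem x hx) y (hmem y hy)) (hRl.trans hsub) hk hve hG

end

/-! ### Fans -/

section

variable {V : Type*} [Fintype V] {G : SimpleGraph V}

-- The edge meets at most `k - 1` others.
open scoped Classical in
theorem FinChoosable.of_adj_degree_le {k : ℕ} {u w : V} (h : G.Adj u w)
    (hd : G.degree u + G.degree w ≤ k + 1) (hG : ∀ G' ≤ G, G' ≠ G → G'.FinChoosable k) :
    G.FinChoosable k := by
  refine FinChoosable.of_edges ![u, w]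
    (injective_vecCons (by simpa using h.ne) (Function.injective_of_subsingleton _))
    (fun _ : Unit => 0) (fun _ => 1) (hG _ (deleteEdges_le _) ?_) (fun _ => h) (fun _ => 1)
    (fun _ => 1) ?_ ?_ ?_
  · intro he
    have h1 := h
    rw [← he, deleteEdges_adj] at h1
    exact h1.2 ⟨(), rfl⟩
  · intro x
    rw [Finset.one_le_card]
    fin_cases x
    · exact ⟨1, by simp⟩
    · exact ⟨0, by simp⟩
  · intro _
    change 1 + G.degree u + G.degree w ≤ k + 1 + 1
    omega
  · intro S hS
    obtain ⟨a, ha⟩ := Finset.card_pos.1 (hS ())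
    exact ⟨fun _ => a, fun _ => ha, fun i j hij => absurd (Subsingleton.elim i j) hij⟩

open scoped Classical in
/-- A vertex `v` of large degree, a small set `W` of vertices, and the set `S` of neighbours of `v`
outside of `W`, all of whose neighbours are in `W`. -/
structure IsFan (G : SimpleGraph V) (k ω : ℕ) (v : V) (W S : Finset V) : Prop where
  mem : v ∈ W
  card_le : W.card ≤ ω + 1
  le_degree : k + 2 ≤ 2 * G.degree v
  degree_le : G.degree v ≤ S.card + (W.filter fun w => G.Adj v w).card
  adj : ∀ x ∈ S, G.Adj v x
  notMem : ∀ x ∈ S, x ∉ W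
  mem_of_adj : ∀ x ∈ S, ∀ y, G.Adj x y → y ∈ W
  degree_le_width : ∀ x ∈ S, G.degree x ≤ ω
  le_degree_add : ∀ x ∈ S, k + 2 ≤ G.degree v + G.degree x

open scoped Classical in
theorem IsBagSequence.exists_isFan {m : ℕ} {c : ℕ → Finset V} (h : G.IsBagSequence m c) {ω k : ℕ}
    (hω : ∀ j < m, (c j).card ≤ ω + 1) (hadj : ∃ u w, G.Adj u w)
    (hsum : ∀ u w, G.Adj u w → k + 2 ≤ G.degree u + G.degree w) :
    ∃ v W S, G.IsFan k ω v W S ∧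
      ((∀ y i j l, i ≤ j → j ≤ l → l < m → y ∈ c i → y ∈ c l → y ∈ c j) →
        ∃ W' ⊆ W, W'.card ≤ ω ∧ ∀ x ∈ S, ∀ y, G.Adj x y → y ∈ W') := by
  obtain ⟨v, W, hv, hvW, hW, hS, hconv⟩ := h.exists_vertex hω (fun x => k + 2 ≤ 2 * G.degree x)
    (by
      obtain ⟨u, w, huw⟩ := hadj
      have := hsum u w huw
      rcases le_total (G.degree u) (G.degree w) with hle | hle
      · exact ⟨w, by omega⟩
      · exact ⟨u, by omega⟩)
    (fun x y hxy => by have := hsum x y hxy; omega)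
  have hmS : ∀ x, x ∈ (G.neighborFinset v).filter (· ∉ W) ↔ G.Adj v x ∧ x ∉ W := by simp
  refine ⟨v, W, (G.neighborFinset v).filter (· ∉ W), ⟨hvW, hW, hv, ?_, fun x hx =>
    ((hmS x).1 hx).1, fun x hx => ((hmS x).1 hx).2, fun x hx =>
    (hS x ((hmS x).1 hx).1 ((hmS x).1 hx).2).2.1, fun x hx => ?_, fun x hx =>
    hsum v x ((hmS x).1 hx).1⟩, fun hc => ?_⟩
  · rw [← card_neighborFinset_eq_degree]
    refine (Finset.card_le_card (t := (G.neighborFinset v).filter (· ∉ W) ∪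
      W.filter fun w => G.Adj v w) fun x hx => ?_).trans (Finset.card_union_le _ _)
    simp only [Finset.mem_union, Finset.mem_filter]
    rw [mem_neighborFinset] at hx ⊢
    tauto
  · obtain ⟨B, hB, hxB⟩ := (hS x ((hmS x).1 hx).1 ((hmS x).1 hx).2).2.2
    rw [← card_neighborFinset_eq_degree]
    exact (Finset.card_le_card fun y hy => hxB y ((mem_neighborFinset ..).1 hy)).trans hB
  · obtain ⟨W', hW', hxW'⟩ := hconv hc
    refine ⟨W ∩ W', Finset.inter_subset_left, (Finset.card_le_card Finset.inter_subset_right).trans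
      hW', fun x hx y hxy => Finset.mem_inter.2 ⟨?_, ?_⟩⟩
    · exact (hS x ((hmS x).1 hx).1 ((hmS x).1 hx).2).2.1 y hxy
    · exact hxW' x ((hmS x).1 hx).1 ((hmS x).1 hx).2 y hxy

/-- With `d` the degree of a fan vertex and `m` its mask; `q` says that label `3` does not occur. -/
theorem mask_mem {p₁ p₂ p₃ q : Prop} [Decidable p₁] [Decidable p₂] [Decidable p₃] (h : q → ¬ p₃) :
    let d := 1 + (if p₁ then 1 else 0) + (if p₂ then 1 else 0) + (if p₃ then 1 else 0)
    let m := (if p₁ then 1 else 0) + (if p₂ then 2 else 0) + (if p₃ then 4 else 0)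
    (2 ≤ d → m ∈ [1, 2, 3, 4, 5, 6, 7]) ∧ (3 ≤ d → m ∈ [3, 5, 6, 7]) ∧ (4 ≤ d → m ∈ [7]) ∧
    (2 ≤ d → d ≤ 3 → m ∈ [1, 2, 3, 4, 5, 6]) ∧ (d = 3 → m ∈ [3, 5, 6]) ∧
    (q → 2 ≤ d → m ∈ [1, 2, 3]) ∧ (q → 3 ≤ d → m ∈ [3]) := by
  by_cases p₁ <;> by_cases p₂ <;> by_cases p₃ <;> simp_all

namespace IsFan

variable {k ω : ℕ} {v : V} {W S : Finset V}

theorem not_adj (h : G.IsFan k ω v W S) : ∀ x ∈ S, ∀ y ∈ S, ¬ G.Adj x y := fun x hx y hy hxy =>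
  h.notMem y hy (h.mem_of_adj x hx y hxy)

open scoped Classical in
theorem card_filter_le (h : G.IsFan k ω v W S) : (W.filter fun w => G.Adj v w).card ≤ ω := by
  have h1 : (W.filter fun w => G.Adj v w) ⊆ W.erase v := fun w hw => by
    rw [Finset.mem_filter] at hw
    exact Finset.mem_erase.2 ⟨hw.2.ne', hw.1⟩
  have h2 := Finset.card_le_card h1
  have h3 := Finset.card_erase_add_one h.mem
  have h4 := h.card_le
  omega

-- At most `ω` neighbours of `v` lie in `W`. If that many are needed to reach the degree of `v`,
-- they are all of `W` except `v`.
open scoped Classical in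
theorem adj_of_degree_le (h : G.IsFan k ω v W S) (hd : S.card + ω ≤ G.degree v) {w : V}
    (hw : w ∈ W) (hwv : w ≠ v) : G.Adj v w := by
  have h1 : (W.filter fun w => G.Adj v w) ⊆ W.erase v := fun w hw => by
    rw [Finset.mem_filter] at hw
    exact Finset.mem_erase.2 ⟨hw.2.ne', hw.1⟩
  have h3 := Finset.card_erase_add_one h.mem
  have h4 := h.card_le
  have h5 := h.degree_le
  have h6 := Finset.eq_of_subset_of_card_le h1 (by omega)
  have h7 : w ∈ W.filter fun w => G.Adj v w := h6 ▸ Finset.mem_erase.2 ⟨hwv, hw⟩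
  exact (Finset.mem_filter.1 h7).2

open scoped Classical in
/-- The mask of a vertex in `S` has one bit for each neighbour other than `v`. -/
theorem vertexMask_mem (h : G.IsFan k ω v W S) {W' : Finset V} (hvW' : v ∈ W')
    (hW' : ∀ x ∈ S, ∀ y, G.Adj x y → y ∈ W') {f : V → Fin 4} (hf : Set.InjOn f W')
    (hfv : f v = 0) {x : V} (hx : x ∈ S) :
    (2 ≤ G.degree x → vertexMask G W' f x ∈ [1, 2, 3, 4, 5, 6, 7]) ∧
    (3 ≤ G.degree x → vertexMask G W' f x ∈ [3, 5, 6, 7]) ∧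
    (4 ≤ G.degree x → vertexMask G W' f x ∈ [7]) ∧
    (2 ≤ G.degree x → G.degree x ≤ 3 → vertexMask G W' f x ∈ [1, 2, 3, 4, 5, 6]) ∧
    (G.degree x = 3 → vertexMask G W' f x ∈ [3, 5, 6]) ∧
    ((∀ w ∈ W', (f w : ℕ) < 3) → 2 ≤ G.degree x → vertexMask G W' f x ∈ [1, 2, 3]) ∧
    ((∀ w ∈ W', (f w : ℕ) < 3) → 3 ≤ G.degree x → vertexMask G W' f x ∈ [3]) := by
  have hd := degree_eq_of_labelling hf hvW' hfv (h.adj x hx) (hW' x hx)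
  have h3 : (∀ w ∈ W', (f w : ℕ) < 3) → ¬ ∃ w ∈ W', f w = 3 ∧ G.Adj x w := by
    rintro hlt ⟨w, hw, h3, -⟩
    have := hlt w hw
    rw [h3] at this
    exact absurd this (by decide)
  rw [hd, vertexMask]
  exact mask_mem h3

end IsFan

end

/-! ### Reducibility of fans -/

section

variable {V : Type*} [Fintype V] {G : SimpleGraph V} {k : ℕ} {v : V} {W S : Finset V}

-- If no table applies, the three fan vertices see the three different pairs among the other
-- vertices `a`, `b`, `c` of `W`. The degree of `v` forces it to be adjacent to all of these, which
-- completes the wheel with six spokes.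
open scoped Classical in
theorem IsFan.finChoosable_seven (h : G.IsFan 7 3 v W S) (hS : S.card = 3) (hdv : G.degree v = 6)
    (hd3 : ∀ x ∈ S, G.degree x = 3) {f : V → Fin 4} (hf : Set.InjOn f W) (hfv : f v = 0)
    (hk : ∀ w, G.degree w ≤ 7) (hG : ∀ G' ≤ G, G' ≠ G → G'.FinChoosable 7) :
    G.FinChoosable 7 := by
  have hmask := fun x hx => (h.vertexMask_mem h.mem h.mem_of_adj hf hfv (x := x) hx).2.2.2.2.1
  have hmem : ∀ x ∈ S.toList, x ∈ S := fun x hx => Finset.mem_toList.1 hx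
  obtain ⟨l, hl, hsub⟩ := exists_subperm_of_searchAll (l := S.toList.map (vertexMask G W f))
    (by simpa [hS] using searchAll_excess_three) (by
      intro m hm
      obtain ⟨x, hx, rfl⟩ := List.mem_map.1 hm
      exact hmask x (hmem x hx) (hd3 x (hmem x hx)))
  rw [Bool.or_eq_true, decide_eq_true_eq] at hl
  rcases hl with hl | rfl
  · obtain ⟨R, hR, hRl⟩ := exists_of_containsTable hl
    exact FinChoosable.of_rowMask_subperm (isValidTable_of_mem (Or.inr rfl) hR) hf h.mem hfv
      S.nodup_toList (fun x hx => h.adj x (hmem x hx)) (fun x hx => h.mem_of_adj x (hmem x hx))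
      (fun x hx y hy => h.not_adj x (hmem x hx) y (hmem y hy)) (hRl.trans hsub) hk
      (by omega) hG
  · obtain ⟨ys, hys, he⟩ := exists_eq_map_of_subperm_map _ hsub
    obtain ⟨x₂, x₃, x₁, rfl⟩ : ∃ x y z, ys = [x, y, z] := by
      have hlen := congrArg List.length he
      simp only [List.length_map, List.length_cons, List.length_nil] at hlen
      exact List.length_eq_three.1 hlen.symm
    simp only [List.map_cons, List.map_nil, List.cons.injEq, and_true] at he
    have hx₁ : x₁ ∈ S := hmem _ (hys.subset (by simp))
    have hx₂ : x₂ ∈ S := hmem _ (hys.subset (by simp))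
    have hx₃ : x₃ ∈ S := hmem _ (hys.subset (by simp))
    have hW4 : W.card = 4 := by
      have h1 : (W.filter fun w => G.Adj v w) ⊆ W.erase v := fun w hw => by
        rw [Finset.mem_filter] at hw
        exact Finset.mem_erase.2 ⟨hw.2.ne', hw.1⟩
      have h2 := Finset.card_le_card h1
      have h3 := Finset.card_erase_add_one h.mem
      have h4 := h.card_le
      have h5 := h.degree_le
      omega
    have hsurj : ∀ j, ∃ w ∈ W, f w = j := by
      intro j
      have := Finset.eq_univ_of_card (W.image f) (by
        rw [Finset.card_image_of_injOn hf, hW4, Fintype.card_fin])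
      simpa using (this ▸ Finset.mem_univ j : j ∈ W.image f)
    obtain ⟨a, ha, hfa⟩ := hsurj 1
    obtain ⟨b, hb, hfb⟩ := hsurj 2
    obtain ⟨c, hc, hfc⟩ := hsurj 3
    have hadj : ∀ w ∈ W, f w ≠ 0 → G.Adj v w := fun w hw hfw =>
      h.adj_of_degree_le (by omega) hw fun he => hfw (he ▸ hfv)
    -- The rows `ρ` are dummies without ranks that only spell out the masks `3`, `6` and `5`.
    have e₁ := fun {w : V} (hw : w ∈ W) => adj_iff_of_rowMask_eq (ρ := [1, 1, 1, 0]) hf h.mem hfv (h.adj x₁ hx₁) (by decide)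
      (by rw [← he.2.2]; decide) hw
    have e₂ := fun {w : V} (hw : w ∈ W) => adj_iff_of_rowMask_eq (ρ := [1, 0, 1, 1]) hf h.mem hfv (h.adj x₂ hx₂) (by decide)
      (by rw [← he.1]; decide) hw
    have e₃ := fun {w : V} (hw : w ∈ W) => adj_iff_of_rowMask_eq (ρ := [1, 1, 0, 1]) hf h.mem hfv (h.adj x₃ hx₃) (by decide)
      (by rw [← he.2.1]; decide) hw
    have hne : ∀ {w w' : V}, f w ≠ f w' → w ≠ w' := fun h he => h (he ▸ rfl)
    have hne' : ∀ {w x : V}, w ∈ W → x ∈ S → w ≠ x := fun hw hx he => h.notMem _ hx (he ▸ hw)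
    have hnm : ∀ {x y : V}, vertexMask G W f x ≠ vertexMask G W f y → x ≠ y := fun h he =>
      h (he ▸ rfl)
    refine FinChoosable.of_three_triples ![v, a, b, c, x₁, x₂, x₃] ?_ ?_ ?_ hG
    · refine injective_vecCons ?_ (injective_vecCons ?_ (injective_vecCons ?_ (injective_vecCons ?_
        (injective_vecCons ?_ (injective_vecCons ?_ (Function.injective_of_subsingleton _))))))
      · have h1 : v ≠ a := hne (by rw [hfv, hfa]; decide)
        have h2 : v ≠ b := hne (by rw [hfv, hfb]; decide)
        have h3 : v ≠ c := hne (by rw [hfv, hfc]; decide)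
        simp [Fin.forall_fin_succ, h1, h2, h3, hne' h.mem hx₁, hne' h.mem hx₂, hne' h.mem hx₃]
      · have h2 : a ≠ b := hne (by rw [hfa, hfb]; decide)
        have h3 : a ≠ c := hne (by rw [hfa, hfc]; decide)
        simp [Fin.forall_fin_succ, h2, h3, hne' ha hx₁, hne' ha hx₂, hne' ha hx₃]
      · have h3 : b ≠ c := hne (by rw [hfb, hfc]; decide)
        simp [Fin.forall_fin_succ, h3, hne' hb hx₁, hne' hb hx₂, hne' hb hx₃]
      · simp [Fin.forall_fin_succ, hne' hc hx₁, hne' hc hx₂, hne' hc hx₃]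
      · have h2 : x₁ ≠ x₂ := hnm (by rw [← he.1, ← he.2.2]; decide)
        have h3 : x₁ ≠ x₃ := hnm (by rw [← he.2.1, ← he.2.2]; decide)
        simp [Fin.forall_fin_succ, h2, h3]
      · have h3 : x₂ ≠ x₃ := hnm (by rw [← he.2.1, ← he.1]; decide)
        simp [h3]
    · intro i
      fin_cases i
      · exact hadj a ha (by rw [hfa]; decide)
      · exact hadj b hb (by rw [hfb]; decide)
      · exact hadj c hc (by rw [hfc]; decide)
      · exact ((e₁ ha).2 (by rw [hfa]; decide)).symm
      · exact ((e₃ ha).2 (by rw [hfa]; decide)).symm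
      · exact ((e₁ hb).2 (by rw [hfb]; decide)).symm
      · exact ((e₂ hb).2 (by rw [hfb]; decide)).symm
      · exact ((e₂ hc).2 (by rw [hfc]; decide)).symm
      · exact ((e₃ hc).2 (by rw [hfc]; decide)).symm
      · exact h.adj x₁ hx₁
      · exact h.adj x₂ hx₂
      · exact h.adj x₃ hx₃
    · intro j
      fin_cases j
      · exact hdv.le
      · exact hk a
      · exact hk b
      · exact hk c
      · exact (hd3 x₁ hx₁).le
      · exact (hd3 x₂ hx₂).le
      · exact (hd3 x₃ hx₃).le

open scoped Classical in
/-- Fans are reducible in graphs of tree-width at most `3`. -/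
theorem IsFan.finChoosable_of_treeWidth (h : G.IsFan k 3 v W S) (hk7 : 7 ≤ k)
    (hk : ∀ w, G.degree w ≤ k) (hG : ∀ G' ≤ G, G' ≠ G → G'.FinChoosable k) :
    G.FinChoosable k := by
  obtain ⟨f, hf, hfv, -⟩ := exists_labelling W h.mem h.card_le
  have hmask := fun x hx => h.vertexMask_mem h.mem h.mem_of_adj hf hfv (x := x) hx
  have h1 := h.degree_le
  have h2 := h.card_filter_le
  have h3 := h.le_degree
  have h4 := hk v
  obtain ⟨x₀, hx₀⟩ : S.Nonempty := Finset.card_pos.1 (by omega)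
  have h5 := h.degree_le_width x₀ hx₀
  have h6 := h.le_degree_add x₀ hx₀
  -- Fan vertices have degree at most `3` and `deg v + deg x ≥ k + 2`, so `deg v` is `k` or `k - 1`;
  -- in the latter case all of them have degree `3`.
  by_cases hd : G.degree v = k
  · refine FinChoosable.of_searchAll (Or.inl rfl) searchAll_triples_pairs hf h.mem hfv
      (by omega : 4 ≤ S.card) h.adj h.mem_of_adj h.not_adj (fun x hx => ?_) hk (by omega) hG
    have := h.le_degree_add x hx
    exact (hmask x hx).2.2.2.1 (by omega) (h.degree_le_width x hx)
  · have hd3 : ∀ x ∈ S, G.degree x = 3 := fun x hx => by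
      have := h.le_degree_add x hx
      have := h.degree_le_width x hx
      omega
    by_cases hS : 4 ≤ S.card
    · exact FinChoosable.of_searchAll (Or.inr rfl) searchAll_excess_four hf h.mem hfv
        hS h.adj h.mem_of_adj h.not_adj (fun x hx => (hmask x hx).2.2.2.2.1 (hd3 x hx)) hk
        (by omega) hG
    -- At most three fan vertices and `deg v = k - 1 ≥ 6` leave only `k = 7`.
    · obtain rfl : k = 7 := by omega
      exact h.finChoosable_seven (by omega) (by omega) hd3 hf hfv hk hG

-- Both fan vertices have all of `W' = {v, a, b}` as neighbours, and `deg v = 2 + 3` forces `v` to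
-- be adjacent to `a` and `b`: this is the wheel with four spokes.
open scoped Classical in
theorem IsFan.finChoosable_six (h : G.IsFan 6 3 v W S) {W' : Finset V} (hWW : W' ⊆ W)
    (hW'3 : W'.card ≤ 3) (hW' : ∀ x ∈ S, ∀ y, G.Adj x y → y ∈ W') (hS : S.card = 2)
    (hdv : G.degree v = 5) (hd3 : ∀ x ∈ S, G.degree x = 3) (hk : ∀ w, G.degree w ≤ 6)
    (hG : ∀ G' ≤ G, G' ≠ G → G'.FinChoosable 6) : G.FinChoosable 6 := by
  obtain ⟨x₁, x₂, hx, rfl⟩ := Finset.card_eq_two.1 hS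
  have hx₁ : x₁ ∈ ({x₁, x₂} : Finset V) := by simp
  have hx₂ : x₂ ∈ ({x₁, x₂} : Finset V) := by simp
  have hadj : ∀ x ∈ ({x₁, x₂} : Finset V), ∀ w ∈ W', G.Adj x w := by
    intro x hx w hw
    have h1 : G.neighborFinset x = W' := by
      refine Finset.eq_of_subset_of_card_le (fun y hy => hW' x hx y ((mem_neighborFinset ..).1 hy))
        ?_
      rw [card_neighborFinset_eq_degree, hd3 x hx]
      exact hW'3
    rw [← mem_neighborFinset, h1]
    exact hw
  have hv : v ∈ W' := hW' x₁ hx₁ v (h.adj x₁ hx₁).symm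
  have hcard : (W'.erase v).card = 2 := by
    have h1 := Finset.card_erase_add_one hv
    have h2 : G.degree x₁ ≤ W'.card := by
      rw [← card_neighborFinset_eq_degree]
      exact Finset.card_le_card fun y hy => hW' x₁ hx₁ y ((mem_neighborFinset ..).1 hy)
    rw [hd3 x₁ hx₁] at h2
    omega
  obtain ⟨a, b, hab, heq⟩ := Finset.card_eq_two.1 hcard
  have ha : a ∈ W'.erase v := by simp [heq]
  have hb : b ∈ W'.erase v := by simp [heq]
  rw [Finset.mem_erase] at ha hb
  have hne : ∀ {w x : V}, w ∈ W' → x ∈ ({x₁, x₂} : Finset V) → w ≠ x := fun hw hx he =>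
    h.notMem _ hx (he ▸ hWW hw)
  have hva := h.adj_of_degree_le (by omega) (hWW ha.2) ha.1
  have hvb := h.adj_of_degree_le (by omega) (hWW hb.2) hb.1
  refine FinChoosable.of_two_triples ![v, a, b, x₁, x₂] ?_ ?_ ?_ hG
  · refine injective_vecCons ?_ (injective_vecCons ?_ (injective_vecCons ?_ (injective_vecCons ?_
      (Function.injective_of_subsingleton _))))
    · simp [Fin.forall_fin_succ, ha.1.symm, hb.1.symm, hne hv hx₁, hne hv hx₂]
    · simp [Fin.forall_fin_succ, hab, hne ha.2 hx₁, hne ha.2 hx₂]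
    · simp [Fin.forall_fin_succ, hne hb.2 hx₁, hne hb.2 hx₂]
    · simp [hx]
  · intro i
    fin_cases i
    · exact hva
    · exact hvb
    · exact (hadj x₁ hx₁ a ha.2).symm
    · exact (hadj x₂ hx₂ a ha.2).symm
    · exact (hadj x₁ hx₁ b hb.2).symm
    · exact (hadj x₂ hx₂ b hb.2).symm
    · exact h.adj x₁ hx₁
    · exact h.adj x₂ hx₂
  · intro j
    fin_cases j
    · exact hdv.le
    · exact hk a
    · exact hk b
    · exact (hd3 x₁ hx₁).le
    · exact (hd3 x₂ hx₂).le

open scoped Classical in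
/-- Fans are reducible in graphs of path-width at most `3`. -/
theorem IsFan.finChoosable_of_pathWidth_three (h : G.IsFan 6 3 v W S) {W' : Finset V}
    (hWW : W' ⊆ W) (hW'3 : W'.card ≤ 3) (hW' : ∀ x ∈ S, ∀ y, G.Adj x y → y ∈ W')
    (hk : ∀ w, G.degree w ≤ 6) (hG : ∀ G' ≤ G, G' ≠ G → G'.FinChoosable 6) :
    G.FinChoosable 6 := by
  have h1 := h.degree_le
  have h2 := h.card_filter_le
  have h3 := h.le_degree
  have h4 := hk v
  obtain ⟨x₀, hx₀⟩ : S.Nonempty := Finset.card_pos.1 (by omega)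
  have h5 := h.degree_le_width x₀ hx₀
  have h6 := h.le_degree_add x₀ hx₀
  have hv : v ∈ W' := hW' x₀ hx₀ v (h.adj x₀ hx₀).symm
  obtain ⟨f, hf, hfv, hf3⟩ := exists_labelling W' hv (by omega)
  have hf3' : ∀ w ∈ W', (f w : ℕ) < 3 := fun w hw => (hf3 w hw).trans_le hW'3
  have hmask := fun x hx => h.vertexMask_mem hv hW' hf hfv (x := x) hx
  by_cases hd : G.degree v = 6
  · refine FinChoosable.of_searchAll (Or.inl rfl) searchAll_two_columns hf hv hfv
      (by omega : 3 ≤ S.card) h.adj hW' h.not_adj (fun x hx => ?_) hk (by omega) hG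
    have := h.le_degree_add x hx
    exact (hmask x hx).2.2.2.2.2.1 hf3' (by omega)
  · have hd3 : ∀ x ∈ S, G.degree x = 3 := fun x hx => by
      have := h.le_degree_add x hx
      have := h.degree_le_width x hx
      omega
    by_cases hS : 3 ≤ S.card
    · exact FinChoosable.of_searchAll (Or.inl rfl) searchAll_two_columns_full hf hv hfv
        hS h.adj hW' h.not_adj (fun x hx => (hmask x hx).2.2.2.2.2.2 hf3' (hd3 x hx).ge) hk
        (by omega) hG
    · exact h.finChoosable_six hWW hW'3 hW' (by omega) (by omega) hd3 hk hG

open scoped Classical in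
/-- Fans are reducible in graphs of path-width at most `4`. -/
theorem IsFan.finChoosable_of_pathWidth_four (h : G.IsFan k 4 v W S) (hk10 : 10 ≤ k)
    {W' : Finset V} (hW'4 : W'.card ≤ 4) (hW' : ∀ x ∈ S, ∀ y, G.Adj x y → y ∈ W')
    (hk : ∀ w, G.degree w ≤ k) (hG : ∀ G' ≤ G, G' ≠ G → G'.FinChoosable k) :
    G.FinChoosable k := by
  have h1 := h.degree_le
  have h2 := h.card_filter_le
  have h3 := h.le_degree
  have h4 := hk v
  obtain ⟨x₀, hx₀⟩ : S.Nonempty := Finset.card_pos.1 (by omega)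
  have h5 := h.degree_le_width x₀ hx₀
  have h6 := h.le_degree_add x₀ hx₀
  have hv : v ∈ W' := hW' x₀ hx₀ v (h.adj x₀ hx₀).symm
  obtain ⟨f, hf, hfv, -⟩ := exists_labelling W' hv hW'4
  have hmask := fun x hx => h.vertexMask_mem hv hW' hf hfv (x := x) hx
  have hdx := h.le_degree_add
  -- Fan vertices have degree at most `4`. Each unit missing from `deg v` removes a fan vertex from
  -- the count but raises the minimum degree of the others.
  obtain hd | hd | hd : G.degree v = k ∨ G.degree v + 1 = k ∨ G.degree v + 2 = k := by omega
  · refine FinChoosable.of_searchAll (Or.inl rfl) searchAll_all hf hv hfv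
      (by omega : 6 ≤ S.card) h.adj hW' h.not_adj (fun x hx => ?_) hk (by omega) hG
    exact (hmask x hx).1 (by have := hdx x hx; omega)
  · refine FinChoosable.of_searchAll (Or.inr rfl) searchAll_excess hf hv hfv
      (by omega : 5 ≤ S.card) h.adj hW' h.not_adj (fun x hx => ?_) hk (by omega) hG
    exact (hmask x hx).2.1 (by have := hdx x hx; omega)
  · refine FinChoosable.of_searchAll (Or.inl rfl) searchAll_full hf hv hfv
      (by omega : 4 ≤ S.card) h.adj hW' h.not_adj (fun x hx => ?_) hk (by omega) hG
    exact (hmask x hx).2.2.1 (by have := hdx x hx; omega)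

open scoped Classical in
/-- A graph with a bag sequence is `k`-edge-choosable if fans are reducible. -/
theorem IsBagSequence.finChoosable {m ω : ℕ} {c : ℕ → Finset V} (h : G.IsBagSequence m c)
    (hω : ∀ j < m, (c j).card ≤ ω + 1) (hk : ∀ w, G.degree w ≤ k)
    (hfan : ∀ (G' : SimpleGraph V) (v : V) (W S : Finset V), G'.IsFan k ω v W S →
      ((∀ y i j l, i ≤ j → j ≤ l → l < m → y ∈ c i → y ∈ c l → y ∈ c j) →
        ∃ W' ⊆ W, W'.card ≤ ω ∧ ∀ x ∈ S, ∀ y, G'.Adj x y → y ∈ W') →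
      (∀ w, G'.degree w ≤ k) → (∀ G'' ≤ G', G'' ≠ G' → G''.FinChoosable k) → G'.FinChoosable k) :
    G.FinChoosable k := by
  induction hn : G.edgeFinset.card using Nat.strong_induction_on generalizing G with
  | _ n ih =>
  -- Subgraphs inherit the bags and the degree bound; this is why `k` is a bound and not the maximum
  -- degree.
  have hG : ∀ G' ≤ G, G' ≠ G → G'.FinChoosable k := fun G' hle hne =>
    ih _ (hn ▸ Finset.card_lt_card (edgeFinset_ssubset_edgeFinset.2 (lt_of_le_of_ne hle hne)))
      (h.mono hle) (fun w => (degree_le_of_le hle).trans (hk w)) rfl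
  by_cases hadj : ∃ u w, G.Adj u w
  · by_cases hsum : ∀ u w, G.Adj u w → k + 2 ≤ G.degree u + G.degree w
    · obtain ⟨v, W, S, hf, hW'⟩ := h.exists_isFan hω hadj hsum
      exact hfan G v W S hf hW' hk hG
    · push Not at hsum
      obtain ⟨u, w, huw, hlt⟩ := hsum
      exact FinChoosable.of_adj_degree_le huw (by omega) hG
  · push Not at hadj
    exact fun L _ => ⟨fun _ => 0, fun u w h => absurd h (hadj u w),
      fun u v w h => absurd h (hadj u v)⟩

end

/-! ### The list chromatic index and the conclusion -/

theorem FinChoosable.edgeChoosable {V : Type*} {G : SimpleGraph V} {k : ℕ}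
    (h : G.FinChoosable k) : G.EdgeChoosable k := by
  classical
  intro L hL
  have hex : ∀ e, ∃ T : Finset ℕ, (T : Set ℕ) ⊆ L e ∧ T.card = k := by
    intro e
    obtain ⟨T, hT, hc⟩ := Set.exists_subset_encard_eq (hL e)
    have hfin : T.Finite := Set.finite_of_encard_eq_coe hc
    refine ⟨hfin.toFinset, by simpa using hT, ?_⟩
    rw [hfin.encard_eq_coe_toFinset_card] at hc
    exact_mod_cast hc
  choose T hT hTc using hex
  obtain ⟨C, hC, hp⟩ := h (fun e => if he : e ∈ G.edgeSet then T ⟨e, he⟩ else ∅) (by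
    intro u w huw
    rw [dif_pos (show s(u, w) ∈ G.edgeSet from huw), hTc])
  refine ⟨fun e => C e, ?_, ?_⟩
  · rintro ⟨e, he⟩
    induction e using Sym2.ind with
    | _ u w =>
      have := hC u w he
      beta_reduce at this
      rw [dif_pos he] at this
      exact hT _ this
  · rintro ⟨e, he⟩ ⟨e', he'⟩ hadj
    rw [lineGraph_adj_iff_exists] at hadj
    obtain ⟨hne, u, hu, hu'⟩ := hadj
    obtain ⟨w, rfl⟩ := hu
    obtain ⟨w', rfl⟩ := hu'
    intro heq
    have := hp u w w' he he' heq
    subst this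
    exact hne rfl

open scoped Classical in
theorem EdgeChoosable.degree_le {V : Type*} [Fintype V] {G : SimpleGraph V} {k : ℕ}
    (h : G.EdgeChoosable k) (v : V) : G.degree v ≤ k := by
  -- With the same `k` colours in every list, the edges at `v` get distinct colours among them.
  obtain ⟨C, hC, hp⟩ := h (fun _ => (Finset.range k : Set ℕ)) (by
    intro e
    rw [Set.encard_coe_eq_coe_finsetCard, Finset.card_range])
  rw [← card_neighborFinset_eq_degree]
  have := Finset.card_le_card_of_injOn (s := G.neighborFinset v) (t := Finset.range k)
    (fun w => if hw : G.Adj v w then C ⟨s(v, w), hw⟩ else 0) ?_ ?_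
  · simpa using this
  · intro w hw
    rw [Finset.mem_coe, mem_neighborFinset] at hw
    simpa [hw] using hC ⟨s(v, w), hw⟩
  · intro w hw w' hw' heq
    rw [Finset.mem_coe, mem_neighborFinset] at hw hw'
    simp only [hw, hw', dif_pos] at heq
    by_contra hne
    refine hp _ _ ?_ heq
    rw [lineGraph_adj_iff_exists]
    exact ⟨fun h => hne (Sym2.congr_right.1 (Subtype.mk.inj h)), v, Sym2.mem_mk_left _ _,
      Sym2.mem_mk_left _ _⟩

theorem FinChoosable.listChromaticIndex_eq {V : Type*} [Fintype V] {G : SimpleGraph V}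
    [DecidableRel G.Adj] (h : G.FinChoosable G.maxDegree) : G.listChromaticIndex = G.maxDegree := by
  refine le_antisymm (Nat.sInf_le h.edgeChoosable) (le_csInf ⟨_, h.edgeChoosable⟩ fun k hk => ?_)
  exact maxDegree_le_of_forall_degree_le _ k fun v => by
    convert hk.degree_le v

/-- The tree decomposition with a single bag. -/
def trivialTreeDecomposition {V : Type*} [Fintype V] (G : SimpleGraph V) : G.TreeDecomposition where
  node := Fin 1
  finite_node := inferInstance
  tree := pathGraph 1
  isTree := ⟨pathGraph_connected 0, .of_subsingleton⟩
  bag _ := Finset.univ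
  exists_mem_bag v := ⟨0, Finset.mem_univ v⟩
  exists_adj_mem_bag v w _ := ⟨0, Finset.mem_univ v, Finset.mem_univ w⟩
  mem_bag_of_mem_path v _ _ _ _ _ _ _ _ := Finset.mem_univ v

theorem exists_treeDecomposition_of_treeWidth_le {V : Type*} [Fintype V] {G : SimpleGraph V} {k : ℕ}
    (h : G.treeWidth ≤ k) : ∃ D : G.TreeDecomposition, D.HasWidth k := by
  -- The single-bag decomposition makes the set of widths nonempty, so the infimum is attained and
  -- is not the default `0`.
  obtain ⟨D, hD⟩ := Nat.sInf_mem (s := {k : ℕ | ∃ D : G.TreeDecomposition, D.HasWidth k})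
    ⟨Fintype.card V, G.trivialTreeDecomposition, fun _ => Nat.le_succ _⟩
  exact ⟨D, fun t => (hD t).trans (Nat.add_le_add_right h 1)⟩

theorem exists_treeDecomposition_of_pathWidth_le {V : Type*} [Fintype V] {G : SimpleGraph V} {k : ℕ}
    (h : G.pathWidth ≤ k) :
    ∃ D : G.TreeDecomposition, D.IsPathDecomposition ∧ D.HasWidth k := by
  obtain ⟨D, hP, hD⟩ := Nat.sInf_mem
    (s := {k : ℕ | ∃ D : G.TreeDecomposition, D.IsPathDecomposition ∧ D.HasWidth k})
    ⟨Fintype.card V, G.trivialTreeDecomposition, ⟨1, ⟨Iso.refl⟩⟩, fun _ => Nat.le_succ _⟩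
  exact ⟨D, hP, fun t => (hD t).trans (Nat.add_le_add_right h 1)⟩

open scoped Classical in
theorem TreeDecomposition.finChoosable_of_hasWidth_three {V : Type*} [Fintype V]
    {G : SimpleGraph V} {k : ℕ} (D : G.TreeDecomposition) (hD : D.HasWidth 3) (hk7 : 7 ≤ k)
    (hk : ∀ w, G.degree w ≤ k) : G.FinChoosable k := by
  obtain ⟨m, c, hc, hcD⟩ := D.exists_isBagSequence
  refine hc.finChoosable (ω := 3) (fun j hj => ?_) hk fun G' v W S hf _ hk' hG =>
    hf.finChoosable_of_treeWidth hk7 hk' hG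
  obtain ⟨t, ht⟩ := hcD j hj
  exact ht ▸ hD t

end SimpleGraph

theorem theorem1 {V : Type*} [Fintype V] (G : SimpleGraph V) [DecidableRel G.Adj] :
    (G.treeWidth ≤ 3 → 7 ≤ G.maxDegree → G.listChromaticIndex = G.maxDegree) ∧
    (G.pathWidth ≤ 3 → 6 ≤ G.maxDegree → G.listChromaticIndex = G.maxDegree) ∧
    (G.pathWidth ≤ 4 → 10 ≤ G.maxDegree → G.listChromaticIndex = G.maxDegree) := by
  classical
  refine ⟨fun hw hΔ => ?_, fun hw hΔ => ?_, fun hw hΔ => ?_⟩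
  · obtain ⟨D, hD⟩ := SimpleGraph.exists_treeDecomposition_of_treeWidth_le hw
    refine (D.finChoosable_of_hasWidth_three hD hΔ fun w => ?_).listChromaticIndex_eq
    convert G.degree_le_maxDegree w
  · obtain ⟨D, hP, hD⟩ := SimpleGraph.exists_treeDecomposition_of_pathWidth_le hw
    -- Only `Δ = 6` needs the path; larger degrees are covered by the result for tree-width `3`.
    rcases hΔ.eq_or_lt with h6 | h7
    · obtain ⟨m, c, hc, hcD, hconv⟩ := D.exists_isBagSequence_of_path hP
      refine (hc.finChoosable (ω := 3) (fun j hj => ?_) (fun w => ?_)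
        fun G' v W S hf hW' hk' hG => ?_).listChromaticIndex_eq
      · obtain ⟨t, ht⟩ := hcD j hj
        exact ht ▸ hD t
      · convert G.degree_le_maxDegree w
      · obtain ⟨W', hWW, hW'3, hSW⟩ := hW' hconv
        rw [← h6] at hf hk' hG ⊢
        exact hf.finChoosable_of_pathWidth_three hWW hW'3 hSW hk' hG
    · refine (D.finChoosable_of_hasWidth_three hD h7 fun w => ?_).listChromaticIndex_eq
      convert G.degree_le_maxDegree w
  · obtain ⟨D, hP, hD⟩ := SimpleGraph.exists_treeDecomposition_of_pathWidth_le hw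
    obtain ⟨m, c, hc, hcD, hconv⟩ := D.exists_isBagSequence_of_path hP
    refine (hc.finChoosable (ω := 4) (fun j hj => ?_) (fun w => ?_)
      fun G' v W S hf hW' hk' hG => ?_).listChromaticIndex_eq
    · obtain ⟨t, ht⟩ := hcD j hj
      exact ht ▸ hD t
    · convert G.degree_le_maxDegree w
    · obtain ⟨W', -, hW'4, hSW⟩ := hW' hconv
      exact hf.finChoosable_of_pathWidth_four hΔ hW'4 hSW hk' hG
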